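/- Let $k$ be a field and let $M$, $H$ be Hopf algebras over $k$ forming a cocycle-free bicrossproduct: $H$ acts on $M$ from the left, $h\otimes m\mapsto h\triangleright m$, making $M$ a left $H$-module algebra; $M$ coacts on $H$ from the right, $\alpha(h)=h^{(1)}\otimes h^{(2)}\in H\otimes M$, making $H$ a right $M$-comodule coalgebra; and $\epsilon(h\triangleright m)=\epsilon(h)\epsilon(m)$, $\Delta(h\triangleright m)=h_1{}^{(1)}\triangleright m_1\otimes h_1{}^{(2)}(h_2\triangleright m_2)$, $\alpha(1)=1\otimes 1$, $\alpha(gh)=g_1{}^{(1)}h^{(1)}\otimes g_1{}^{(2)}(g_2\triangleright h^{(2)})$, $h_2{}^{(1)}\otimes(h_1\triangleright m)h_2{}^{(2)}=h_1{}^{(1)}\otimes h_1{}^{(2)}(h_2\triangleright m)$. Let $P=M\blacktriangleright\!\!\!\triangleleft H$ be the resulting Hopf algebra on $M\otimes H$, with product $(m\otimes h)(n\otimes g)=m(h_1\triangleright n)\otimes h_2g$, coproduct $\Delta(m\otimes h)=m_1\otimes h_1{}^{(1)}\otimes m_2h_1{}^{(2)}\otimes h_2$, unit $1\otimes 1$ and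 counit $\epsilon\otimes\epsilon$. Put $\pi(m\otimes h)=\epsilon(m)h$, $\Delta_R=(\mathrm{id}\otimes\pi)\Delta:P\to P\otimes H$ (whose coinvariants are $M=M\otimes 1$), and $\Phi(h)=1\otimes h$, so that $P$ is a trivial quantum principal $H$-bundle over $M$ with trivialisation $\Phi$ and $\Phi^{-1}=\Phi\circ S$. For an algebra $A$ write $\Omega^1A=\ker(A\otimes A\to A)$ and $d_Ua=1\otimes a-a\otimes 1$; for a Hopf algebra write $\pi_\epsilon(a)=a-\epsilon(a)1$, $\mathrm{Ad}(a)=a_2\otimes S(a_1)a_3$, $\Delta_L(u\otimes v)=u_1v_1\otimes u_2\otimes v_2$, and call a linear map $f$ into $\Omega^1A$ left-invariant if $\Delta_L(f(x))=1\otimes f(x)$ for all $x$. A connection on $P$ is a linear map $\omega_U:\ker\epsilon_H\to\Omega^1P$ with $\chi\circ\omega_U=1\otimes\mathrm{id}$, where $\chi(u\otimes v)=u\Delta_R(v)$, and $\Delta_R\circ\omega_U=(\omega_U\otimes\mathrm{id})\circ\mathrm{Ad}$, where $\Delta_R$ is extended to $P\otimes P$ as the tensor product coaction. It is strong if $(\mathrm{id}-\Pi)(d_UP)\subseteq(\Omega^1M)P$,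 where $\Pi=\cdot\,(\mathrm{id}\otimes\omega_U)\chi$ on $\Omega^1P$. (1) The assignment $$\omega_U(h)=\Phi^{-1}(h_1)\,\beta_U(\pi_\epsilon(h_2))\,\Phi(h_3)+\Phi^{-1}(h_1)\,d_U\Phi(h_2)$$ is a bijection from the set of left-invariant linear maps $\beta_U:\ker\epsilon_H\to\Omega^1M$ such that, for all $h\in H$, $$\beta_U(\pi_\epsilon(h_1))h_2{}^{(2)}\otimes h_2{}^{(1)}-h_1{}^{(2)}\beta_U(\pi_\epsilon(h_2))\otimes h_1{}^{(1)}=-\,d_Uh^{(2)}\otimes h^{(1)}$$ onto the set of strong left-invariant connections on $P$. (2) The assignment $\beta_U(h)=S(\gamma(h)_1)\,d_U\gamma(h)_2$, $h\in\ker\epsilon_H$, is a bijection from the set of linear maps $\gamma:H\to M$ with $\gamma(1)=1$, $\epsilon_M\circ\gamma=\epsilon_H$ and $$\gamma(h_1)h_2{}^{(2)}\otimes h_2{}^{(1)}=\gamma(h_2)\otimes h_1\qquad\text{for all }h\in H$$ onto the set of maps $\beta_U$ in (1). (3) For each such $\gamma$, the map $i(h)=\gamma(h_1)\otimes h_2$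 restricts to a linear map $i:\ker\epsilon_H\to\ker\epsilon_P$ with $\pi\circ i=\mathrm{id}$ and $(\mathrm{id}\otimes\pi)\circ\mathrm{Ad}\circ i=(i\otimes\mathrm{id})\circ\mathrm{Ad}$, and the connection $\omega_U$ corresponding to $\gamma$ by (2) and (1) is the canonical connection of this splitting, $\omega_U(h)=S(i(h)_1)\,d_U\,i(h)_2$. -/

import Mathlib

open scoped TensorProduct

noncomputable section

namespace QPB

/-- Convolution of linear maps from a coalgebra to an algebra: `h ↦ f(h₁) g(h₂)`. -/
def conv {k C A : Type*} [CommSemiring k] [AddCommMonoid C] [Module k C] [Coalgebra k C]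
    [Semiring A] [Algebra k A] (f g : C →ₗ[k] A) : C →ₗ[k] A :=
  LinearMap.mul' k A ∘ₗ TensorProduct.map f g ∘ₗ Coalgebra.comul

section conv

variable {k C A B : Type*} [CommSemiring k] [AddCommMonoid C] [Module k C] [Coalgebra k C]
  [Semiring A] [Algebra k A] [Semiring B] [Algebra k B]

theorem conv_apply (f g : C →ₗ[k] A) (c : C) :
    conv f g c = LinearMap.mul' k A (TensorProduct.map f g (Coalgebra.comul c)) := rfl

theorem conv_assoc (f g h : C →ₗ[k] A) : conv (conv f g) h = conv f (conv g h) :=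
  congrArg WithConv.ofConv
    (mul_assoc (WithConv.toConv f) (WithConv.toConv g) (WithConv.toConv h))

theorem algHom_comp_conv (φ : A →ₐ[k] B) (f g : C →ₗ[k] A) :
    φ.toLinearMap ∘ₗ conv f g = conv (φ.toLinearMap ∘ₗ f) (φ.toLinearMap ∘ₗ g) :=
  LinearMap.algHom_comp_convMul_distrib φ (WithConv.toConv f) (WithConv.toConv g)

theorem mulLeft_comp_conv (x : A) (f g : C →ₗ[k] A) :
    LinearMap.mulLeft k x ∘ₗ conv f g = conv (LinearMap.mulLeft k x ∘ₗ f) g := by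
  ext c
  simp only [LinearMap.comp_apply, conv_apply]
  induction Coalgebra.comul (R := k) c with
  | zero => simp
  | tmul a b => simp [mul_assoc]
  | add a b ha hb => simp only [map_add, ha, hb]

theorem mulRight_comp_conv (x : A) (f g : C →ₗ[k] A) :
    LinearMap.mulRight k x ∘ₗ conv f g = conv f (LinearMap.mulRight k x ∘ₗ g) := by
  ext c
  simp only [LinearMap.comp_apply, conv_apply]
  induction Coalgebra.comul (R := k) c with
  | zero => simp
  | tmul a b => simp [mul_assoc]
  | add a b ha hb => simp only [map_add, ha, hb]

theorem conv_mulRight_left (x : A) (f g : C →ₗ[k] A) :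
    conv (LinearMap.mulRight k x ∘ₗ f) g = conv f (LinearMap.mulLeft k x ∘ₗ g) := by
  ext c
  simp only [conv_apply]
  induction Coalgebra.comul (R := k) c with
  | zero => simp
  | tmul a b => simp [mul_assoc]
  | add a b ha hb => simp only [map_add, ha, hb]

end conv

/-- Data of a cocycle-free bicrossproduct `M ▶◁ H`. The Hopf algebra `H` acts on `M` from the left,
making `M` a left `H`-module algebra, and the Hopf algebra `M` coacts on `H` from the right,
`h ↦ h⁽¹⁾ ⊗ h⁽²⁾ ∈ H ⊗ M`, making `H` a right `M`-comodule coalgebra; the last five fields are the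
usual compatibility conditions of a bicrossproduct. -/
structure MatchedPair (k M H : Type*) [Field k] [Ring M] [Ring H] [HopfAlgebra k M]
    [HopfAlgebra k H] where
  /-- the action `h ▷ m` -/
  act : H →ₐ[k] Module.End k M
  /-- the coaction `h ↦ h⁽¹⁾ ⊗ h⁽²⁾` -/
  coact : H →ₗ[k] H ⊗[k] M
  /-- `h ▷ 1 = ε(h) 1` -/
  act_one : ∀ h, act h 1 = algebraMap k M (Coalgebra.counit h)
  /-- `h ▷ (m n) = (h₁ ▷ m) (h₂ ▷ n)` -/
  act_mul : ∀ m n, act.toLinearMap.flip (m * n) =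
    conv (act.toLinearMap.flip m) (act.toLinearMap.flip n)
  /-- `h⁽¹⁾⁽¹⁾ ⊗ h⁽¹⁾⁽²⁾ ⊗ h⁽²⁾ = h⁽¹⁾ ⊗ h⁽²⁾₁ ⊗ h⁽²⁾₂` -/
  coact_coassoc : ∀ h, TensorProduct.assoc k H M M (coact.rTensor M (coact h)) =
    (Coalgebra.comul (R := k) (A := M)).lTensor H (coact h)
  /-- `h⁽¹⁾ ε(h⁽²⁾) = h` -/
  coact_counit : ∀ h, TensorProduct.rid k H
    ((Coalgebra.counit (R := k) (A := M)).lTensor H (coact h)) = h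
  /-- `ε(h⁽¹⁾) h⁽²⁾ = ε(h) 1` -/
  counit_coact : ∀ h, TensorProduct.lid k M
    ((Coalgebra.counit (R := k) (A := H)).rTensor M (coact h)) =
      algebraMap k M (Coalgebra.counit h)
  /-- `h⁽¹⁾₁ ⊗ h⁽¹⁾₂ ⊗ h⁽²⁾ = h₁⁽¹⁾ ⊗ h₂⁽¹⁾ ⊗ h₁⁽²⁾ h₂⁽²⁾` -/
  comul_coact : (Coalgebra.comul (R := k) (A := H)).rTensor M ∘ₗ coact =
    conv
      ((Algebra.TensorProduct.map Algebra.TensorProduct.includeLeft (AlgHom.id k M) :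
        H ⊗[k] M →ₐ[k] (H ⊗[k] H) ⊗[k] M).toLinearMap ∘ₗ coact)
      ((Algebra.TensorProduct.map Algebra.TensorProduct.includeRight (AlgHom.id k M) :
        H ⊗[k] M →ₐ[k] (H ⊗[k] H) ⊗[k] M).toLinearMap ∘ₗ coact)
  /-- `ε(h ▷ m) = ε(h) ε(m)` -/
  counit_act : ∀ h m, Coalgebra.counit (R := k) (act h m) =
    Coalgebra.counit (R := k) h * Coalgebra.counit (R := k) m
  /-- `Δ(h ▷ m) = (h₁⁽¹⁾ ▷ m₁) ⊗ h₁⁽²⁾ (h₂ ▷ m₂)`. The right hand side is `Δ m` transformed by the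
  convolution, in the algebra of endomorphisms of `M ⊗ M`, of
  `h ↦ (m ⊗ n ↦ (h⁽¹⁾ ▷ m) ⊗ h⁽²⁾ n)` and `h ↦ (m ⊗ n ↦ m ⊗ (h ▷ n))`. -/
  comul_act : ∀ h m, Coalgebra.comul (R := k) (act h m) =
    (conv (A := Module.End k (M ⊗[k] M))
      (TensorProduct.homTensorHomMap (RingHom.id k) M M M M ∘ₗ
        TensorProduct.map act.toLinearMap (LinearMap.mul k M) ∘ₗ coact)
      (LinearMap.lTensorHom M ∘ₗ act.toLinearMap) h) (Coalgebra.comul (R := k) m)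
  /-- `1⁽¹⁾ ⊗ 1⁽²⁾ = 1 ⊗ 1` -/
  coact_one : coact 1 = 1
  /-- `(g h)⁽¹⁾ ⊗ (g h)⁽²⁾ = g₁⁽¹⁾ h⁽¹⁾ ⊗ g₁⁽²⁾ (g₂ ▷ h⁽²⁾)` -/
  coact_mul : ∀ h, coact ∘ₗ LinearMap.mulRight k h =
    conv coact ((LinearMap.lTensorHom H ∘ₗ act.toLinearMap).flip (coact h))
  /-- `h₂⁽¹⁾ ⊗ (h₁ ▷ m) h₂⁽²⁾ = h₁⁽¹⁾ ⊗ h₁⁽²⁾ (h₂ ▷ m)` -/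
  act_coact : ∀ m,
    conv ((Algebra.TensorProduct.includeRight : M →ₐ[k] H ⊗[k] M).toLinearMap ∘ₗ
        act.toLinearMap.flip m) coact =
    conv coact ((Algebra.TensorProduct.includeRight : M →ₐ[k] H ⊗[k] M).toLinearMap ∘ₗ
        act.toLinearMap.flip m)

/-- The underlying vector space `M ⊗ H` of the bicrossproduct `M ▶◁ H`. -/
def Bicross {k M H : Type*} [Field k] [Ring M] [Ring H] [HopfAlgebra k M]
    [HopfAlgebra k H] (_D : MatchedPair k M H) : Type _ := M ⊗[k] H

namespace Bicross

variable {k M H : Type*} [Field k] [Ring M] [Ring H] [HopfAlgebra k M] [HopfAlgebra k H]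
  (D : MatchedPair k M H)

instance : AddCommGroup (Bicross D) := inferInstanceAs (AddCommGroup (M ⊗[k] H))

instance : Module k (Bicross D) := inferInstanceAs (Module k (M ⊗[k] H))

/-- The identification of `M ⊗ H` with `M ▶◁ H`. -/
def of : M ⊗[k] H ≃ₗ[k] Bicross D := LinearEquiv.refl k (M ⊗[k] H)

/-- `m ⊗ h` as an element of `M ▶◁ H`. -/
def tm (m : M) (h : H) : Bicross D := of D (m ⊗ₜ[k] h)

variable {D} in
theorem induction {p : Bicross D → Prop} (zero : p 0) (tmul : ∀ m h, p (tm D m h))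
    (add : ∀ x y, p x → p y → p (x + y)) (x : Bicross D) : p x :=
  TensorProduct.induction_on (motive := fun x => p (of D x)) ((of D).symm x) zero tmul add

/-- `h ⊗ n ↦ (h₁ ▷ n) ⊗ h₂` -/
def cross : H ⊗[k] M →ₗ[k] M ⊗[k] H :=
  (TensorProduct.lift D.act.toLinearMap).rTensor H ∘ₗ
    (TensorProduct.rightComm k H H M).toLinearMap ∘ₗ
      (Coalgebra.comul (R := k) (A := H)).rTensor M

/-- The cross product `(m ⊗ h) (n ⊗ g) = m (h₁ ▷ n) ⊗ h₂ g`. -/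
def mulMap : (M ⊗[k] H) ⊗[k] (M ⊗[k] H) →ₗ[k] M ⊗[k] H :=
  TensorProduct.map (LinearMap.mul' k M) (LinearMap.mul' k H) ∘ₗ
    (TensorProduct.assoc k M M (H ⊗[k] H)).symm.toLinearMap ∘ₗ
    ((TensorProduct.assoc k M H H).toLinearMap ∘ₗ (cross D).rTensor H ∘ₗ
      (TensorProduct.assoc k H M H).symm.toLinearMap).lTensor M ∘ₗ
    (TensorProduct.assoc k M H (M ⊗[k] H)).toLinearMap

instance : Mul (Bicross D) :=
  ⟨fun x y => of D (mulMap D ((of D).symm x ⊗ₜ[k] (of D).symm y))⟩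

instance : One (Bicross D) := ⟨tm D 1 1⟩

theorem one_eq : (1 : Bicross D) = tm D 1 1 := rfl

theorem mul_eq (x y : Bicross D) :
    x * y = of D (mulMap D ((of D).symm x ⊗ₜ[k] (of D).symm y)) := rfl

theorem tm_mul_tm (m n : M) (h g : H) : tm D m h * tm D n g =
    of D (TensorProduct.map (LinearMap.mulLeft k m ∘ₗ D.act.toLinearMap.flip n)
      (LinearMap.mulRight k g) (Coalgebra.comul h)) := by
  simp only [mul_eq, tm, LinearEquiv.symm_apply_apply, mulMap, cross, LinearMap.comp_apply,
    LinearEquiv.coe_coe, TensorProduct.assoc_tmul, LinearMap.lTensor_tmul,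
    TensorProduct.assoc_symm_tmul, LinearMap.rTensor_tmul]
  congr 1
  induction Coalgebra.comul (R := k) h with
  | zero => simp
  | tmul a b => simp
  | add a b ha hb => simp only [TensorProduct.add_tmul, TensorProduct.tmul_add, map_add, ha, hb]

theorem zero_mul_aux (y : Bicross D) : 0 * y = 0 := by simp [mul_eq]
theorem mul_zero_aux (y : Bicross D) : y * 0 = 0 := by simp [mul_eq]
theorem add_mul_aux (x y z : Bicross D) : (x + y) * z = x * z + y * z := by
  simp [mul_eq, TensorProduct.add_tmul]
theorem mul_add_aux (x y z : Bicross D) : x * (y + z) = x * y + x * z := by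
  simp [mul_eq, TensorProduct.tmul_add]
theorem smul_mul_aux (c : k) (x y : Bicross D) : (c • x) * y = c • (x * y) := by
  simp [mul_eq, ← TensorProduct.smul_tmul']
theorem mul_smul_aux (c : k) (x y : Bicross D) : x * (c • y) = c • (x * y) := by
  simp [mul_eq]

section lift

variable {A : Type*} [Semiring A] [Algebra k A] (l : M →ₐ[k] A) (r : H →ₐ[k] A)

/-- `m ⊗ h ↦ l(m) r(h)` -/
def liftLin : Bicross D →ₗ[k] A :=
  LinearMap.mul' k A ∘ₗ TensorProduct.map l.toLinearMap r.toLinearMap ∘ₗ (of D).symm.toLinearMap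

theorem liftLin_tm (m : M) (h : H) : liftLin D l r (tm D m h) = l m * r h := by
  simp [liftLin, tm]

/-- The relation `r(h) l(n) = l(h₁ ▷ n) r(h₂)`. -/
def CrossRel : Prop := ∀ n, LinearMap.mulRight k (l n) ∘ₗ r.toLinearMap =
  conv (l.toLinearMap ∘ₗ D.act.toLinearMap.flip n) r.toLinearMap

variable {D l r}

theorem liftLin_mul (hlr : CrossRel D l r) (x y : Bicross D) :
    liftLin D l r (x * y) = liftLin D l r x * liftLin D l r y := by
  induction x using induction with
  | zero => simp [zero_mul_aux]
  | add x x' h h' => simp only [add_mul_aux, map_add, h, h', add_mul]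
  | tmul m h =>
  induction y using induction with
  | zero => simp [mul_zero_aux]
  | add x x' h h' => simp only [mul_add_aux, map_add, h, h', mul_add]
  | tmul n g =>
  have key := LinearMap.congr_fun (hlr n) h
  simp only [LinearMap.comp_apply, LinearMap.mulRight_apply, AlgHom.toLinearMap_apply,
    conv_apply] at key
  rw [liftLin_tm, liftLin_tm, mul_assoc, ← mul_assoc (r h), key, tm_mul_tm]
  induction Coalgebra.comul (R := k) h with
  | zero => simp
  | add a b ha hb => simp only [map_add, ha, hb, add_mul, mul_add]
  | tmul a b =>
    have := liftLin_tm D l r (m * D.act a n) (b * g)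
    simp only [tm] at this
    simp [this, mul_assoc]

theorem liftLin_one : liftLin D l r 1 = 1 := by simp [one_eq, liftLin_tm]

end lift

/-- `h ↦ (h₁ ▷ ·) ⊗ h₂` -/
def regH : H →ₐ[k] (Module.End k M) ⊗[k] H :=
  (Algebra.TensorProduct.map D.act (AlgHom.id k H)).comp (Bialgebra.comulAlgHom k H)

/-- `m ↦ (m ·) ⊗ 1` -/
def regM : M →ₐ[k] (Module.End k M) ⊗[k] H :=
  (Algebra.TensorProduct.includeLeft).comp (Algebra.lmul k M)

theorem reg_rel : CrossRel D (regM (H := H)) (regH D) := by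
  intro n
  have h1 : (regH D).toLinearMap = conv
      ((Algebra.TensorProduct.includeLeft : _ →ₐ[k] (Module.End k M) ⊗[k] H).toLinearMap ∘ₗ
        D.act.toLinearMap)
      (Algebra.TensorProduct.includeRight : _ →ₐ[k] (Module.End k M) ⊗[k] H).toLinearMap := by
    ext h
    simp only [conv_apply, regH, AlgHom.toLinearMap_apply, AlgHom.comp_apply,
      Bialgebra.comulAlgHom_apply]
    induction Coalgebra.comul (R := k) h with
    | zero => simp
    | add a b ha hb => simp only [map_add, ha, hb]
    | tmul a b => simp
  have h2 : LinearMap.mulRight k (Algebra.lmul k M n) ∘ₗ D.act.toLinearMap =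
      conv ((Algebra.lmul k M).toLinearMap ∘ₗ D.act.toLinearMap.flip n) D.act.toLinearMap := by
    ext h m
    have := LinearMap.congr_fun (D.act_mul n m) h
    simp only [conv_apply, LinearMap.flip_apply, AlgHom.toLinearMap_apply] at this
    simp only [LinearMap.comp_apply, AlgHom.toLinearMap_apply, LinearMap.mulRight_apply,
      Module.End.mul_apply, conv_apply]
    refine Eq.trans this ?_
    induction Coalgebra.comul (R := k) h with
    | zero => simp
    | add a b ha hb => simp only [map_add, ha, hb, LinearMap.add_apply]
    | tmul a b => simp
  set inc : Module.End k M →ₐ[k] (Module.End k M) ⊗[k] H := Algebra.TensorProduct.includeLeft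
    with hinc
  set inr : H →ₐ[k] (Module.End k M) ⊗[k] H := Algebra.TensorProduct.includeRight with hinr
  have h3 : LinearMap.mulRight k (regM (k := k) (H := H) n) ∘ₗ inr.toLinearMap =
      LinearMap.mulLeft k (regM (k := k) (H := H) n) ∘ₗ inr.toLinearMap := by
    ext h
    simp [hinr, regM]
  have h4 : LinearMap.mulRight k (regM (k := k) (H := H) n) ∘ₗ (inc.toLinearMap ∘ₗ D.act.toLinearMap) =
      inc.toLinearMap ∘ₗ (LinearMap.mulRight k (Algebra.lmul k M n) ∘ₗ D.act.toLinearMap) := by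
    ext h
    simp [hinc, regM]
  rw [h1, mulRight_comp_conv, h3, ← conv_mulRight_left, h4, h2, algHom_comp_conv, conv_assoc]
  rfl

theorem reg_injective : Function.Injective (liftLin D (regM (H := H)) (regH D)) := by
  have : ((LinearMap.applyₗ (1 : M)).rTensor H : (Module.End k M) ⊗[k] H →ₗ[k] M ⊗[k] H) ∘ₗ
      liftLin D (regM (H := H)) (regH D) = (of D).symm.toLinearMap := by
    apply LinearMap.ext
    intro x
    induction x using induction with
    | zero => simp
    | add x y hx hy => simp only [map_add, hx, hy]
    | tmul m h =>
      have key : TensorProduct.map (LinearMap.mulLeft k m ∘ₗ Algebra.linearMap k M ∘ₗ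
        Coalgebra.counit) LinearMap.id (Coalgebra.comul (R := k) h) = m ⊗ₜ h := by
        rw [← LinearMap.comp_assoc, ← LinearMap.map_comp_rTensor, LinearMap.comp_apply,
          Coalgebra.rTensor_counit_comul]
        simp
      rw [LinearMap.comp_apply, liftLin_tm, LinearEquiv.coe_coe, tm,
        LinearEquiv.symm_apply_apply]
      refine Eq.trans ?_ key
      simp only [regH, AlgHom.comp_apply, Bialgebra.comulAlgHom_apply]
      induction Coalgebra.comul (R := k) h with
      | zero => simp
      | add a b ha hb => simp only [map_add, ha, hb, mul_add]
      | tmul a b => simp [regM, D.act_one]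
  intro x y hxy
  apply (of D).symm.injective
  have h1 := LinearMap.congr_fun this x
  have h2 := LinearMap.congr_fun this y
  simp only [LinearMap.comp_apply, LinearEquiv.coe_coe] at h1 h2
  rw [← h1, ← h2, hxy]

instance : Ring (Bicross D) :=
  { (inferInstance : AddCommGroup (Bicross D)) with
    left_distrib := mul_add_aux D
    right_distrib := add_mul_aux D
    zero_mul := zero_mul_aux D
    mul_zero := mul_zero_aux D
    mul_assoc := fun x y z =>
      reg_injective D (by simp only [liftLin_mul (reg_rel D), mul_assoc])
    one_mul := fun x =>
      reg_injective D (by simp only [liftLin_mul (reg_rel D), liftLin_one, one_mul])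
    mul_one := fun x =>
      reg_injective D (by simp only [liftLin_mul (reg_rel D), liftLin_one, mul_one]) }

instance : Algebra k (Bicross D) := Algebra.ofModule (smul_mul_aux D) (mul_smul_aux D)

/-- The inclusion `m ↦ m ⊗ 1` of `M` in `M ▶◁ H`. -/
def incl : M →ₐ[k] Bicross D :=
  AlgHom.ofLinearMap ((of D).toLinearMap ∘ₗ (TensorProduct.mk k M H).flip 1) rfl (by
    intro m n
    change tm D (m * n) 1 = tm D m 1 * tm D n 1
    rw [tm_mul_tm]
    simp [tm, Algebra.TensorProduct.one_def])

/-- The trivialisation `Φ(h) = 1 ⊗ h`. -/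
def Phi : H →ₐ[k] Bicross D :=
  AlgHom.ofLinearMap ((of D).toLinearMap ∘ₗ TensorProduct.mk k M H 1) rfl (by
    intro h g
    change tm D 1 (h * g) = tm D 1 h * tm D 1 g
    rw [tm_mul_tm, tm]
    congr 1
    have : (LinearMap.mulLeft k 1 ∘ₗ D.act.toLinearMap.flip 1 : H →ₗ[k] M) =
        Algebra.linearMap k M ∘ₗ Coalgebra.counit := by
      ext h; simp [D.act_one]
    rw [this, ← LinearMap.map_comp_rTensor, LinearMap.comp_apply,
      Coalgebra.rTensor_counit_comul]
    simp)

theorem incl_apply (m : M) : incl D m = tm D m 1 := rfl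
theorem Phi_apply (h : H) : Phi D h = tm D 1 h := rfl

theorem incl_mul_Phi (m : M) (h : H) : incl D m * Phi D h = tm D m h := by
  rw [incl_apply, Phi_apply, tm_mul_tm]
  simp [tm, Algebra.TensorProduct.one_def]

theorem algHom_ext {A : Type*} [Semiring A] [Algebra k A] {f g : Bicross D →ₐ[k] A}
    (h1 : f.comp (incl D) = g.comp (incl D)) (h2 : f.comp (Phi D) = g.comp (Phi D)) : f = g := by
  ext x
  induction x using induction with
  | zero => simp
  | add x y hx hy => simp only [map_add, hx, hy]
  | tmul m h =>
    rw [← incl_mul_Phi, map_mul, map_mul]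
    exact congrArg₂ _ (DFunLike.congr_fun h1 m) (DFunLike.congr_fun h2 h)

/-- The algebra map `m ⊗ h ↦ l(m) r(h)`. -/
def lift {A : Type*} [Semiring A] [Algebra k A] (l : M →ₐ[k] A) (r : H →ₐ[k] A)
    (hlr : CrossRel D l r) : Bicross D →ₐ[k] A :=
  AlgHom.ofLinearMap (liftLin D l r) liftLin_one (liftLin_mul hlr)

theorem lift_tm {A : Type*} [Semiring A] [Algebra k A] (l : M →ₐ[k] A) (r : H →ₐ[k] A)
    (hlr : CrossRel D l r) (m : M) (h : H) : lift D l r hlr (tm D m h) = l m * r h :=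
  liftLin_tm D l r m h

theorem lift_incl {A : Type*} [Semiring A] [Algebra k A] (l : M →ₐ[k] A) (r : H →ₐ[k] A)
    (hlr : CrossRel D l r) (m : M) : lift D l r hlr (incl D m) = l m := by
  rw [incl_apply, lift_tm, map_one, mul_one]

theorem lift_Phi {A : Type*} [Semiring A] [Algebra k A] (l : M →ₐ[k] A) (r : H →ₐ[k] A)
    (hlr : CrossRel D l r) (h : H) : lift D l r hlr (Phi D h) = r h := by
  rw [Phi_apply, lift_tm, map_one, one_mul]

/-- `Φ(h) n = (h₁ ▷ n) Φ(h₂)` -/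
theorem Phi_rel : CrossRel D (incl D) (Phi D) := by
  intro n
  ext h
  simp only [LinearMap.comp_apply, LinearMap.mulRight_apply, AlgHom.toLinearMap_apply, conv_apply]
  rw [Phi_apply, incl_apply, tm_mul_tm]
  induction Coalgebra.comul (R := k) h with
  | zero => simp
  | add a b ha hb => simp only [map_add, ha, hb]
  | tmul a b =>
    have := incl_mul_Phi D (D.act a n) b
    rw [tm] at this
    simp [this]

/-- The counit `ε(m ⊗ h) = ε(m) ε(h)`. -/
def counitHom : Bicross D →ₐ[k] k :=
  lift D (Bialgebra.counitAlgHom k M) (Bialgebra.counitAlgHom k H) (by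
    intro n
    ext h
    have h1 : ((Bialgebra.counitAlgHom k M).toLinearMap ∘ₗ D.act.toLinearMap.flip n) =
        LinearMap.mulRight k (Coalgebra.counit (R := k) n) ∘ₗ
          (Bialgebra.counitAlgHom k H).toLinearMap := by
      ext h; simp [D.counit_act]
    rw [h1, conv_mulRight_left]
    have h2 : Coalgebra.counit (R := k) h = LinearMap.mul' k k (TensorProduct.map
        Coalgebra.counit LinearMap.id (LinearMap.lTensor H Coalgebra.counit
          (Coalgebra.comul (R := k) h))) := by
      rw [Coalgebra.lTensor_counit_comul]; simp
    simp only [LinearMap.comp_apply, conv_apply, LinearMap.mulRight_apply,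
      AlgHom.toLinearMap_apply, Bialgebra.counitAlgHom_apply]
    conv_lhs => rw [h2]
    induction Coalgebra.comul (R := k) h with
    | zero => simp
    | add a b ha hb => simp only [map_add, ha, hb, add_mul]
    | tmul a b => simp [mul_comm, mul_left_comm])

/-- The algebra map `h ⊗ m ↦ Φ(h) ⊗ m` from `H ⊗ M` to `(M ▶◁ H) ⊗ (M ▶◁ H)`. -/
def PhiIncl : H ⊗[k] M →ₐ[k] Bicross D ⊗[k] Bicross D :=
  Algebra.TensorProduct.map (Phi D) (incl D)

/-- `h ↦ Φ(h⁽¹⁾) ⊗ h⁽²⁾` -/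
def coactP : H →ₗ[k] Bicross D ⊗[k] Bicross D := (PhiIncl D).toLinearMap ∘ₗ D.coact

/-- `h ↦ 1 ⊗ Φ(h)` -/
def oneP : H →ₐ[k] Bicross D ⊗[k] Bicross D :=
  (Algebra.TensorProduct.includeRight).comp (Phi D)

theorem oneP_rel (t : H ⊗[k] M) : LinearMap.mulRight k (PhiIncl D t) ∘ₗ (oneP D).toLinearMap =
    conv ((PhiIncl D).toLinearMap ∘ₗ
      (LinearMap.lTensorHom H ∘ₗ D.act.toLinearMap).flip t) (oneP D).toLinearMap := by
  ext h
  induction t with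
  | zero => simp [conv_apply]
  | add a b ha hb =>
    simp only [LinearMap.comp_apply, LinearMap.mulRight_apply, conv_apply, map_add,
      mul_add, LinearMap.comp_add, TensorProduct.map_add_left, LinearMap.add_apply] at ha hb ⊢
    rw [ha, hb]
  | tmul g n =>
    have key := LinearMap.congr_fun (Phi_rel D n) h
    simp only [LinearMap.comp_apply, LinearMap.mulRight_apply, AlgHom.toLinearMap_apply,
      conv_apply] at key
    simp only [LinearMap.comp_apply, LinearMap.mulRight_apply, AlgHom.toLinearMap_apply,
      conv_apply, oneP, PhiIncl, AlgHom.comp_apply, Algebra.TensorProduct.map_tmul,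
      Algebra.TensorProduct.includeRight_apply, Algebra.TensorProduct.tmul_mul_tmul, one_mul, key]
    induction Coalgebra.comul (R := k) h with
    | zero => simp
    | add a b ha hb => simp only [map_add, TensorProduct.tmul_add, ha, hb]
    | tmul a b => simp

/-- `h ↦ Φ(h₁⁽¹⁾) ⊗ h₁⁽²⁾ Φ(h₂)`, the coproduct of `Φ(h)`. -/
def comulPhi : H →ₐ[k] Bicross D ⊗[k] Bicross D :=
  AlgHom.ofLinearMap (conv (coactP D) (oneP D).toLinearMap)
    (by
      rw [conv_apply, Bialgebra.comul_one, Algebra.TensorProduct.one_def, TensorProduct.map_tmul]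
      simp [coactP, D.coact_one])
    (by
      intro g h
      have key : ∀ x, conv (coactP D ∘ₗ LinearMap.mulRight k x) (oneP D).toLinearMap g =
          conv (coactP D) (oneP D).toLinearMap g * coactP D x := by
        intro x
        have h1 : coactP D ∘ₗ LinearMap.mulRight k x = conv (coactP D) ((PhiIncl D).toLinearMap ∘ₗ
            (LinearMap.lTensorHom H ∘ₗ D.act.toLinearMap).flip (D.coact x)) := by
          rw [coactP, LinearMap.comp_assoc, D.coact_mul, algHom_comp_conv]
        rw [h1, conv_assoc, ← oneP_rel, ← mulRight_comp_conv]
        rfl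
      rw [conv_apply _ _ (g * h), conv_apply _ _ h, Bialgebra.comul_mul]
      induction Coalgebra.comul (R := k) h with
      | zero => simp
      | add a b ha hb => simp only [map_add, mul_add, ha, hb]
      | tmul x y =>
        simp only [TensorProduct.map_tmul, LinearMap.mul'_apply, ← mul_assoc, ← key]
        rw [conv_apply]
        induction Coalgebra.comul (R := k) g with
        | zero => simp
        | add a b ha hb => simp only [map_add, add_mul, ha, hb]
        | tmul a b => simp [mul_assoc])

theorem comulPhi_toLinearMap :
    (comulPhi D).toLinearMap = conv (coactP D) (oneP D).toLinearMap := rfl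

/-- `m ↦ m₁ ⊗ m₂`, the coproduct of `M` in `(M ▶◁ H) ⊗ (M ▶◁ H)`. -/
def comulIncl : M →ₐ[k] Bicross D ⊗[k] Bicross D :=
  (Algebra.TensorProduct.map (incl D) (incl D)).comp (Bialgebra.comulAlgHom k M)

/-- `h ↦ (h⁽¹⁾ ▷ m) ⊗ h⁽²⁾` -/
def actCoactP (m : M) : H →ₗ[k] Bicross D ⊗[k] Bicross D :=
  (Algebra.TensorProduct.map (incl D) (incl D)).toLinearMap ∘ₗ
    (D.act.toLinearMap.flip m).rTensor M ∘ₗ D.coact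

/-- `h ↦ 1 ⊗ (h ▷ n)` -/
def oneAct (n : M) : H →ₗ[k] Bicross D ⊗[k] Bicross D :=
  ((Algebra.TensorProduct.includeRight).comp (incl D)).toLinearMap ∘ₗ D.act.toLinearMap.flip n

theorem coactP_mul (m : M) : LinearMap.mulRight k (incl D m ⊗ₜ[k] 1) ∘ₗ coactP D =
    conv (actCoactP D m) (coactP D) := by
  let f : (H ⊗[k] H) ⊗[k] M →ₗ[k] Bicross D ⊗[k] Bicross D :=
    TensorProduct.map (LinearMap.mul' k _ ∘ₗ TensorProduct.map
      ((incl D).toLinearMap ∘ₗ D.act.toLinearMap.flip m) (Phi D).toLinearMap) (incl D).toLinearMap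
  have h1 : LinearMap.mulRight k (incl D m ⊗ₜ[k] 1) ∘ₗ coactP D =
      f ∘ₗ (Coalgebra.comul (R := k) (A := H)).rTensor M ∘ₗ D.coact := by
    ext h
    simp only [LinearMap.comp_apply, coactP]
    induction D.coact h with
    | zero => simp
    | add a b ha hb => simp only [map_add, ha, hb]
    | tmul g n =>
      have key := LinearMap.congr_fun (Phi_rel D m) g
      simp only [LinearMap.comp_apply, LinearMap.mulRight_apply, AlgHom.toLinearMap_apply,
        conv_apply] at key
      simp [f, PhiIncl, key]
  rw [h1, D.comul_coact]
  ext h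
  simp only [LinearMap.comp_apply, conv_apply]
  induction Coalgebra.comul (R := k) h with
  | zero => simp
  | add a b ha hb => simp only [map_add, ha, hb]
  | tmul x y =>
    simp only [TensorProduct.map_tmul, LinearMap.mul'_apply, LinearMap.comp_apply, actCoactP,
      coactP]
    induction D.coact x with
    | zero => simp
    | add a b ha hb => simp only [map_add, add_mul, ha, hb]
    | tmul x1 x2 =>
      induction D.coact y with
      | zero => simp
      | add a b ha hb => simp only [map_add, mul_add, ha, hb]
      | tmul y1 y2 => simp [f, PhiIncl]

theorem oneP_mul (n : M) : LinearMap.mulRight k ((1 : Bicross D) ⊗ₜ[k] incl D n) ∘ₗ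
    (oneP D).toLinearMap = conv (oneAct D n) (oneP D).toLinearMap := by
  have h1 := congrArg (fun f => (Algebra.TensorProduct.includeRight :
    _ →ₐ[k] Bicross D ⊗[k] Bicross D).toLinearMap ∘ₗ f) (Phi_rel D n)
  simp only [algHom_comp_conv] at h1
  refine Eq.trans ?_ h1
  ext h
  simp [oneP]

theorem coactP_oneAct (n : M) : conv (coactP D) (oneAct D n) =
    conv (oneAct D n) (coactP D) := by
  have h1 := congrArg (fun f => (PhiIncl D).toLinearMap ∘ₗ f) (D.act_coact n)
  simp only [algHom_comp_conv] at h1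
  have h2 : (PhiIncl D).toLinearMap ∘ₗ (Algebra.TensorProduct.includeRight :
      M →ₐ[k] H ⊗[k] M).toLinearMap ∘ₗ D.act.toLinearMap.flip n = oneAct D n := by
    ext h
    simp [oneAct, PhiIncl]
  rw [h2] at h1
  exact h1.symm

theorem comul_rel : CrossRel D (comulIncl D) (comulPhi D) := by
  intro n
  have key : ∀ m n : M, LinearMap.mulRight k (incl D m ⊗ₜ[k] incl D n) ∘ₗ
      (comulPhi D).toLinearMap =
      conv (conv (actCoactP D m) (oneAct D n)) (comulPhi D).toLinearMap := by
    intro m n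
    have h1 : LinearMap.mulRight k (incl D m ⊗ₜ[k] incl D n) ∘ₗ (oneP D).toLinearMap =
        LinearMap.mulLeft k (incl D m ⊗ₜ[k] 1) ∘ₗ
          LinearMap.mulRight k ((1 : Bicross D) ⊗ₜ[k] incl D n) ∘ₗ (oneP D).toLinearMap := by
      ext h
      simp [oneP]
    rw [comulPhi_toLinearMap, mulRight_comp_conv, h1, ← conv_mulRight_left, coactP_mul,
      oneP_mul, conv_assoc, ← conv_assoc (coactP D), coactP_oneAct, conv_assoc, conv_assoc]
  have h2 : ∀ t : M ⊗[k] M, LinearMap.mulRight k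
      (Algebra.TensorProduct.map (incl D) (incl D) t) ∘ₗ (comulPhi D).toLinearMap =
      conv ((Algebra.TensorProduct.map (incl D) (incl D)).toLinearMap ∘ₗ
        ((conv (A := Module.End k (M ⊗[k] M))
      (TensorProduct.homTensorHomMap (RingHom.id k) M M M M ∘ₗ
        TensorProduct.map D.act.toLinearMap (LinearMap.mul k M) ∘ₗ D.coact)
      (LinearMap.lTensorHom M ∘ₗ D.act.toLinearMap)).flip t)) (comulPhi D).toLinearMap := by
    intro t
    ext h
    induction t with
    | zero => simp [conv_apply]
    | add a b ha hb =>
      simp only [LinearMap.comp_apply, LinearMap.mulRight_apply, conv_apply _ _ h, map_add,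
        mul_add, LinearMap.comp_add, TensorProduct.map_add_left, LinearMap.add_apply] at ha hb ⊢
      rw [ha, hb]
    | tmul m n =>
      rw [Algebra.TensorProduct.map_tmul, key]
      congr 2
      ext h
      simp only [LinearMap.comp_apply, LinearMap.flip_apply, conv_apply]
      induction Coalgebra.comul (R := k) h with
      | zero => simp
      | add a b ha hb => simp only [map_add, ha, hb, LinearMap.add_apply]
      | tmul x y =>
        simp only [TensorProduct.map_tmul, LinearMap.mul'_apply, LinearMap.comp_apply,
          actCoactP, oneAct]
        induction D.coact x with
        | zero => simp
        | add a b ha hb =>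
          simp only [map_add, add_mul, ha, hb, LinearMap.add_apply]
        | tmul x1 x2 => simp
  have h3 := h2 (Coalgebra.comul n)
  refine h3.trans (congrArg (fun f => conv f (comulPhi D).toLinearMap) ?_)
  ext h
  simp only [LinearMap.comp_apply, LinearMap.flip_apply]
  rw [← D.comul_act]
  rfl

/-- The cross coproduct `Δ(m ⊗ h) = m₁ ⊗ h₁⁽¹⁾ ⊗ m₂ h₁⁽²⁾ ⊗ h₂`. -/
def comulHom : Bicross D →ₐ[k] Bicross D ⊗[k] Bicross D :=
  lift D (comulIncl D) (comulPhi D) (comul_rel D)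

theorem comulHom_incl (m : M) : comulHom D (incl D m) =
    Algebra.TensorProduct.map (incl D) (incl D) (Coalgebra.comul m) := lift_incl ..

theorem comulHom_Phi (h : H) : comulHom D (Phi D h) = comulPhi D h := lift_Phi ..

theorem counitHom_incl (m : M) : counitHom D (incl D m) = Coalgebra.counit m := lift_incl ..

theorem counitHom_Phi (h : H) : counitHom D (Phi D h) = Coalgebra.counit h := lift_Phi ..

theorem coassoc_aux : (Algebra.TensorProduct.assoc k k k _ _ _).toAlgHom.comp
      ((Algebra.TensorProduct.map (comulHom D) (.id k (Bicross D))).comp (comulHom D))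
      = (Algebra.TensorProduct.map (.id k (Bicross D)) (comulHom D)).comp (comulHom D) := by
  apply algHom_ext
  · ext m
    have key := congrArg (Algebra.TensorProduct.map (incl D)
      (Algebra.TensorProduct.map (incl D) (incl D))) (Coalgebra.coassoc_apply (R := k) m)
    simp only [AlgHom.comp_apply, comulHom_incl]
    refine Eq.trans (Eq.trans ?_ key) ?_
    · induction Coalgebra.comul (R := k) m with
      | zero => simp
      | add a b ha hb => simp only [map_add, ha, hb]
      | tmul a b =>
        simp only [Algebra.TensorProduct.map_tmul, comulHom_incl, LinearMap.rTensor_tmul]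
        induction Coalgebra.comul (R := k) a with
        | zero => simp
        | add a b ha hb => simp only [map_add, TensorProduct.add_tmul, ha, hb]
        | tmul a a' => simp
    · induction Coalgebra.comul (R := k) m with
      | zero => simp
      | add a b ha hb => simp only [map_add, ha, hb]
      | tmul a b => simp [comulHom_incl]
  · apply AlgHom.toLinearMap_injective
    set as : (Bicross D ⊗[k] Bicross D) ⊗[k] Bicross D →ₐ[k]
        Bicross D ⊗[k] (Bicross D ⊗[k] Bicross D) :=
      (Algebra.TensorProduct.assoc k k k _ _ _).toAlgHom with has
    set f1 := as.comp (Algebra.TensorProduct.map (comulHom D) (.id k (Bicross D))) with hf1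
    set f2 := Algebra.TensorProduct.map (.id k (Bicross D)) (comulHom D) with hf2
    set inr : Bicross D ⊗[k] Bicross D →ₐ[k] Bicross D ⊗[k] (Bicross D ⊗[k] Bicross D) :=
      Algebra.TensorProduct.includeRight with hinr
    have e1 : (((as.comp ((Algebra.TensorProduct.map (comulHom D) (.id k (Bicross D))).comp
        (comulHom D))).comp (Phi D))).toLinearMap = f1.toLinearMap ∘ₗ (comulPhi D).toLinearMap := by
      ext h
      simp [f1, comulHom_Phi]
    have e2 : ((f2.comp (comulHom D)).comp (Phi D)).toLinearMap =
        f2.toLinearMap ∘ₗ (comulPhi D).toLinearMap := by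
      ext h
      simp [comulHom_Phi]
    rw [e1, e2, comulPhi_toLinearMap, algHom_comp_conv, algHom_comp_conv]
    have e3 : f2.toLinearMap ∘ₗ (oneP D).toLinearMap = inr.toLinearMap ∘ₗ
        (comulPhi D).toLinearMap := by
      ext h
      simp [f2, oneP, comulHom_Phi, inr]
    have e4 : f1.toLinearMap ∘ₗ (oneP D).toLinearMap = inr.toLinearMap ∘ₗ
        (oneP D).toLinearMap := by
      ext h
      simp [f1, oneP, inr, as, Algebra.TensorProduct.one_def]
    rw [e3, e4, comulPhi_toLinearMap, algHom_comp_conv, ← conv_assoc]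
    congr 1
    -- the map `(h ⊗ g) ⊗ m ↦ Δ(Φ h)`-part
    let F : (H ⊗[k] H) ⊗[k] M →ₗ[k] Bicross D ⊗[k] (Bicross D ⊗[k] Bicross D) :=
      as.toLinearMap ∘ₗ TensorProduct.map (LinearMap.mul' k _ ∘ₗ
        TensorProduct.map (coactP D) (oneP D).toLinearMap) (incl D).toLinearMap
    have e5 : f1.toLinearMap ∘ₗ coactP D =
        F ∘ₗ (Coalgebra.comul (R := k) (A := H)).rTensor M ∘ₗ D.coact := by
      ext h
      simp only [coactP, LinearMap.comp_apply]
      induction D.coact h with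
      | zero => simp
      | add a b ha hb => simp only [map_add, ha, hb]
      | tmul g n =>
        have : comulPhi D g = LinearMap.mul' k _ (TensorProduct.map (coactP D)
          (oneP D).toLinearMap (Coalgebra.comul g)) := rfl
        simp [f1, PhiIncl, comulHom_Phi, this, as, F]
    -- `h ↦ Φ(h⁽¹⁾) ⊗ Δ(h⁽²⁾)`
    have e6 : f2.toLinearMap ∘ₗ coactP D = as.toLinearMap ∘ₗ
        (TensorProduct.map (coactP D) (incl D).toLinearMap) ∘ₗ D.coact := by
      ext h
      have key := congrArg (TensorProduct.map (Phi D).toLinearMap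
        (TensorProduct.map (incl D).toLinearMap (incl D).toLinearMap)) (D.coact_coassoc h)
      simp only [coactP, LinearMap.comp_apply]
      refine Eq.trans (Eq.trans ?_ key.symm) ?_
      · induction D.coact h with
        | zero => simp
        | add a b ha hb => simp only [map_add, ha, hb]
        | tmul g n =>
          simp only [f2, PhiIncl, AlgHom.toLinearMap_apply, Algebra.TensorProduct.map_tmul,
            comulHom_incl, LinearMap.lTensor_tmul, TensorProduct.map_tmul, AlgHom.id_apply]
          rfl
      · induction D.coact h with
        | zero => simp
        | add a b ha hb => simp only [map_add, ha, hb]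
        | tmul g n =>
          simp only [LinearMap.rTensor_tmul, TensorProduct.map_tmul, LinearMap.comp_apply]
          induction D.coact g with
          | zero => simp
          | add a b ha hb => simp only [map_add, TensorProduct.add_tmul, ha, hb]
          | tmul a b => simp [as, PhiIncl]
    rw [e5, e6, D.comul_coact]
    ext h
    simp only [LinearMap.comp_apply, conv_apply]
    induction Coalgebra.comul (R := k) h with
    | zero => simp
    | add a b ha hb => simp only [map_add, ha, hb]
    | tmul x y =>
      simp only [TensorProduct.map_tmul, LinearMap.mul'_apply, LinearMap.comp_apply]
      have e7 : ∀ t : H ⊗[k] M, inr.toLinearMap (PhiIncl D t) = (1 : Bicross D) ⊗ₜ[k]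
        PhiIncl D t := fun t => rfl
      have e8 : coactP D y = PhiIncl D (D.coact y) := rfl
      rw [e8, e7]
      induction D.coact x with
      | zero => simp
      | add a b ha hb => simp only [map_add, add_mul, ha, hb]
      | tmul x1 x2 =>
        induction D.coact y with
        | zero => simp
        | add a b ha hb =>
          simp only [map_add, mul_add, TensorProduct.tmul_add, ha, hb]
        | tmul y1 y2 =>
          simp only [F, LinearMap.comp_apply, TensorProduct.map_tmul, AlgHom.toLinearMap_apply,
            Algebra.TensorProduct.map_tmul, Algebra.TensorProduct.includeLeft_apply,
            Algebra.TensorProduct.includeRight_apply, Algebra.TensorProduct.tmul_mul_tmul,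
            AlgHom.id_apply, mul_one, one_mul, LinearMap.mul'_apply, map_mul]
          induction coactP D x1 with
          | zero => simp
          | add a b ha hb => simp only [map_add, add_mul, TensorProduct.add_tmul, ha, hb]
          | tmul p q => simp [oneP, PhiIncl, as]

theorem counit_left_aux : (Algebra.TensorProduct.map (counitHom D) (.id k (Bicross D))).comp
    (comulHom D) = (Algebra.TensorProduct.lid k (Bicross D)).symm := by
  apply algHom_ext
  · ext m
    have key := congrArg (TensorProduct.map LinearMap.id (incl D).toLinearMap)
      (Coalgebra.rTensor_counit_comul (R := k) m)
    simp only [AlgHom.comp_apply, comulHom_incl]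
    refine Eq.trans (Eq.trans ?_ key) ?_
    · induction Coalgebra.comul (R := k) m with
      | zero => simp
      | add a b ha hb => simp only [map_add, ha, hb]
      | tmul a b => simp [counitHom_incl]
    · simp
  · ext h
    have e1 : (Algebra.TensorProduct.map (counitHom D) (.id k (Bicross D))).toLinearMap ∘ₗ
        coactP D = Algebra.linearMap k _ ∘ₗ Coalgebra.counit := by
      ext h
      have key := congrArg (fun x => (1 : k) ⊗ₜ[k] incl D x) (D.counit_coact h)
      simp only [coactP, LinearMap.comp_apply]
      refine Eq.trans (Eq.trans ?_ key) ?_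
      · induction D.coact h with
        | zero => simp
        | add a b ha hb => simp only [map_add, TensorProduct.tmul_add, ha, hb]
        | tmul a b =>
          simp [PhiIncl, counitHom_Phi, TensorProduct.smul_tmul']
      · simp [Algebra.algebraMap_eq_smul_one, Algebra.TensorProduct.one_def]
    have e2 := LinearMap.congr_fun (algHom_comp_conv (Algebra.TensorProduct.map (counitHom D)
      (.id k (Bicross D))) (coactP D) (oneP D).toLinearMap) h
    rw [e1] at e2
    have key := congrArg (TensorProduct.map LinearMap.id (Phi D).toLinearMap)
      (Coalgebra.rTensor_counit_comul (R := k) h)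
    simp only [AlgHom.comp_apply, comulHom_Phi]
    refine Eq.trans e2 (Eq.trans (Eq.trans ?_ key) ?_)
    · rw [conv_apply]
      induction Coalgebra.comul (R := k) h with
      | zero => simp
      | add a b ha hb => simp only [map_add, ha, hb]
      | tmul a b => simp [oneP, Algebra.algebraMap_eq_smul_one, TensorProduct.smul_tmul']
    · simp

theorem counit_right_aux : (Algebra.TensorProduct.map (.id k (Bicross D)) (counitHom D)).comp
    (comulHom D) = (Algebra.TensorProduct.rid k k (Bicross D)).symm := by
  apply algHom_ext
  · ext m
    have key := congrArg (TensorProduct.map (incl D).toLinearMap LinearMap.id)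
      (Coalgebra.lTensor_counit_comul (R := k) m)
    simp only [AlgHom.comp_apply, comulHom_incl]
    refine Eq.trans (Eq.trans ?_ key) ?_
    · induction Coalgebra.comul (R := k) m with
      | zero => simp
      | add a b ha hb => simp only [map_add, ha, hb]
      | tmul a b => simp [counitHom_incl]
    · simp
  · ext h
    have e1 : (Algebra.TensorProduct.map (.id k (Bicross D)) (counitHom D)).toLinearMap ∘ₗ
        coactP D = (TensorProduct.mk k _ k).flip 1 ∘ₗ (Phi D).toLinearMap := by
      ext h
      have key := congrArg (fun x => Phi D x ⊗ₜ[k] (1 : k)) (D.coact_counit h)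
      simp only [coactP, LinearMap.comp_apply]
      refine Eq.trans (Eq.trans ?_ key) ?_
      · induction D.coact h with
        | zero => simp
        | add a b ha hb => simp only [map_add, TensorProduct.add_tmul, ha, hb]
        | tmul a b =>
          simp [PhiIncl, counitHom_incl, TensorProduct.smul_tmul]
      · simp
    have e2 := LinearMap.congr_fun (algHom_comp_conv (Algebra.TensorProduct.map
      (.id k (Bicross D)) (counitHom D)) (coactP D) (oneP D).toLinearMap) h
    rw [e1] at e2
    have key := congrArg (TensorProduct.map (Phi D).toLinearMap LinearMap.id)
      (Coalgebra.lTensor_counit_comul (R := k) h)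
    simp only [AlgHom.comp_apply, comulHom_Phi]
    refine Eq.trans e2 (Eq.trans (Eq.trans ?_ key) ?_)
    · rw [conv_apply]
      induction Coalgebra.comul (R := k) h with
      | zero => simp
      | add a b ha hb => simp only [map_add, ha, hb]
      | tmul a b => simp [oneP, counitHom_Phi]
    · simp

instance : Bialgebra k (Bicross D) :=
  Bialgebra.ofAlgHom (comulHom D) (counitHom D) (coassoc_aux D) (counit_left_aux D)
    (counit_right_aux D)

theorem comul_def : (Coalgebra.comul : Bicross D →ₗ[k] _) = (comulHom D).toLinearMap := rfl

theorem counit_def : (Coalgebra.counit : Bicross D →ₗ[k] k) = (counitHom D).toLinearMap := rfl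

theorem comul_tm (m : M) (h : H) : Coalgebra.comul (R := k) (tm D m h) =
    comulIncl D m * comulPhi D h :=
  lift_tm D _ _ (comul_rel D) m h

theorem counit_tm (m : M) (h : H) : Coalgebra.counit (R := k) (tm D m h) =
    Coalgebra.counit (R := k) m * Coalgebra.counit (R := k) h :=
  liftLin_tm D (Bialgebra.counitAlgHom k M) (Bialgebra.counitAlgHom k H) m h

/-- `h ↦ Φ(S h⁽¹⁾) S(h⁽²⁾)`, the antipode of `Φ(h)`. -/
def antipodePhi : H →ₗ[k] Bicross D :=
  LinearMap.mul' k (Bicross D) ∘ₗ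
    TensorProduct.map ((Phi D).toLinearMap ∘ₗ HopfAlgebra.antipode k)
      ((incl D).toLinearMap ∘ₗ HopfAlgebra.antipode k) ∘ₗ D.coact

/-- The antipode `S(m ⊗ h) = Φ(S h⁽¹⁾) S(m h⁽²⁾)` of `M ▶◁ H`, written with
`S(m h⁽²⁾) = S(h⁽²⁾) S(m)`. -/
def antipodeMap : Bicross D →ₗ[k] Bicross D :=
  LinearMap.mul' k (Bicross D) ∘ₗ
    TensorProduct.map (antipodePhi D) ((incl D).toLinearMap ∘ₗ HopfAlgebra.antipode k) ∘ₗ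
    (TensorProduct.comm k M H).toLinearMap ∘ₗ (of D).symm.toLinearMap

theorem antipodeMap_tm (m : M) (h : H) : antipodeMap D (tm D m h) =
    antipodePhi D h * incl D (HopfAlgebra.antipode k m) := by
  simp [antipodeMap, tm]

theorem antipodeMap_Phi (h : H) : antipodeMap D (Phi D h) = antipodePhi D h := by
  rw [Phi_apply, antipodeMap_tm, HopfAlgebra.antipode_one, map_one, mul_one]

theorem antipodeMap_incl_mul (m : M) (x : Bicross D) : antipodeMap D (incl D m * x) =
    antipodeMap D x * incl D (HopfAlgebra.antipode k m) := by
  induction x using induction with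
  | zero => simp
  | add x y hx hy => simp only [mul_add, map_add, hx, hy, add_mul]
  | tmul n h =>
    rw [← incl_mul_Phi, ← mul_assoc, ← map_mul, incl_mul_Phi, incl_mul_Phi, antipodeMap_tm,
      antipodeMap_tm, HopfAlgebra.antipode_mul_antidistrib, map_mul, mul_assoc]

theorem antipode_left_aux : LinearMap.mul' k (Bicross D) ∘ₗ
    (antipodeMap D).rTensor (Bicross D) ∘ₗ Coalgebra.comul =
      Algebra.linearMap k (Bicross D) ∘ₗ Coalgebra.counit := by
  set Q := LinearMap.mul' k (Bicross D) ∘ₗ (antipodeMap D).rTensor (Bicross D) with hQ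
  have h1 : ∀ m t, Q (comulIncl D m * t) = Coalgebra.counit (R := k) m • Q t := by
    intro m t
    induction t with
    | zero => simp
    | add a b ha hb => simp only [mul_add, map_add, ha, hb, smul_add]
    | tmul p q =>
      have key := congrArg (fun x => antipodeMap D p * incl D x * q)
        (HopfAlgebra.mul_antipode_rTensor_comul_apply (R := k) m)
      refine Eq.trans ?_ (Eq.trans key ?_)
      · simp only [comulIncl, AlgHom.comp_apply, Bialgebra.comulAlgHom_apply]
        induction Coalgebra.comul (R := k) m with
        | zero => simp
        | add a b ha hb => simp only [add_mul, mul_add, map_add, ha, hb]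
        | tmul a b => simp [Q, antipodeMap_incl_mul, mul_assoc]
      · simp [Q, Algebra.algebraMap_eq_smul_one]
  have h2 : Q ∘ₗ coactP D = (Phi D).toLinearMap ∘ₗ HopfAlgebra.antipode k := by
    ext h
    let G : H ⊗[k] (M ⊗[k] M) →ₗ[k] Bicross D := LinearMap.mul' k _ ∘ₗ
      TensorProduct.map ((Phi D).toLinearMap ∘ₗ HopfAlgebra.antipode k)
        ((incl D).toLinearMap ∘ₗ LinearMap.mul' k M ∘ₗ (HopfAlgebra.antipode k).rTensor M)
    have key := congrArg G (D.coact_coassoc h)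
    have key2 := congrArg (fun x => Phi D (HopfAlgebra.antipode k x)) (D.coact_counit h)
    simp only [LinearMap.comp_apply, coactP]
    refine Eq.trans ?_ (Eq.trans key (Eq.trans ?_ key2))
    · induction D.coact h with
      | zero => simp
      | add a b ha hb => simp only [map_add, ha, hb]
      | tmul g n =>
        simp only [PhiIncl, AlgHom.toLinearMap_apply, Algebra.TensorProduct.map_tmul, Q,
          LinearMap.comp_apply, LinearMap.rTensor_tmul, LinearMap.mul'_apply, antipodeMap_Phi,
          antipodePhi]
        induction D.coact g with
        | zero => simp
        | add a b ha hb => simp only [map_add, add_mul, TensorProduct.add_tmul, ha, hb]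
        | tmul a b => simp [G, mul_assoc]
    · induction D.coact h with
      | zero => simp
      | add a b ha hb => simp only [map_add, ha, hb]
      | tmul g n => simp [G, Algebra.algebraMap_eq_smul_one]
  have h3 : ∀ h, Q (comulPhi D h) = algebraMap k _ (Coalgebra.counit h) := by
    intro h
    have key := congrArg (Phi D) (HopfAlgebra.mul_antipode_rTensor_comul_apply (R := k) h)
    rw [AlgHom.commutes] at key
    refine Eq.trans ?_ key
    change Q (conv (coactP D) (oneP D).toLinearMap h) = _
    rw [conv_apply]
    induction Coalgebra.comul (R := k) h with
    | zero => simp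
    | add a b ha hb => simp only [map_add, ha, hb]
    | tmul x y =>
      have := LinearMap.congr_fun h2 x
      simp only [LinearMap.comp_apply, AlgHom.toLinearMap_apply] at this
      simp only [TensorProduct.map_tmul, LinearMap.mul'_apply, LinearMap.rTensor_tmul, map_mul,
        ← this]
      induction coactP D x with
      | zero => simp
      | add a b ha hb => simp only [map_add, add_mul, ha, hb]
      | tmul p q => simp [oneP, Q, mul_assoc]
  apply LinearMap.ext
  intro x
  induction x using induction with
  | zero => simp
  | add x y hx hy => simp only [map_add, hx, hy]
  | tmul m h =>
    refine Eq.trans (congrArg Q (comul_tm D m h)) (Eq.trans ?_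
      (congrArg (algebraMap k (Bicross D)) (counit_tm D m h)).symm)
    rw [h1, h3]
    simp [Algebra.smul_def]

theorem antipode_right_aux : LinearMap.mul' k (Bicross D) ∘ₗ
    (antipodeMap D).lTensor (Bicross D) ∘ₗ Coalgebra.comul =
      Algebra.linearMap k (Bicross D) ∘ₗ Coalgebra.counit := by
  set Q := LinearMap.mul' k (Bicross D) ∘ₗ (antipodeMap D).lTensor (Bicross D) with hQ
  let G : (H ⊗[k] H) ⊗[k] M →ₗ[k] Bicross D := LinearMap.mul' k _ ∘ₗ
      TensorProduct.map ((Phi D).toLinearMap ∘ₗ LinearMap.mul' k H ∘ₗ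
        (HopfAlgebra.antipode k).lTensor H) ((incl D).toLinearMap ∘ₗ HopfAlgebra.antipode k)
  have h3 : ∀ h, Q (comulPhi D h) = algebraMap k _ (Coalgebra.counit h) := by
    intro h
    have key := congrArg G (LinearMap.congr_fun D.comul_coact h)
    have key2 := congrArg (fun x => incl D (HopfAlgebra.antipode k x)) (D.counit_coact h)
    have e1 : incl D (HopfAlgebra.antipode k (algebraMap k M (Coalgebra.counit h))) =
        algebraMap k _ (Coalgebra.counit h) := by
      simp [Algebra.algebraMap_eq_smul_one]
    rw [e1] at key2
    refine Eq.trans ?_ (Eq.trans key.symm (Eq.trans ?_ key2))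
    · change Q (conv (coactP D) (oneP D).toLinearMap h) = _
      rw [conv_apply, conv_apply]
      induction Coalgebra.comul (R := k) h with
      | zero => simp
      | add a b ha hb => simp only [map_add, ha, hb]
      | tmul x y =>
        simp only [TensorProduct.map_tmul, LinearMap.mul'_apply, coactP, LinearMap.comp_apply]
        induction D.coact x with
        | zero => simp
        | add a b ha hb => simp only [map_add, add_mul, ha, hb]
        | tmul x1 x2 =>
          simp only [PhiIncl, oneP, AlgHom.toLinearMap_apply, Algebra.TensorProduct.map_tmul, Q,
            AlgHom.comp_apply, Algebra.TensorProduct.includeRight_apply,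
            Algebra.TensorProduct.tmul_mul_tmul, mul_one,
            LinearMap.comp_apply, LinearMap.lTensor_tmul, LinearMap.mul'_apply,
            antipodeMap_incl_mul, antipodeMap_Phi, antipodePhi]
          induction D.coact y with
          | zero => simp
          | add a b ha hb => simp only [map_add, add_mul, mul_add, ha, hb]
          | tmul y1 y2 =>
            simp [G, mul_assoc, HopfAlgebra.antipode_mul_antidistrib]
    · simp only [LinearMap.comp_apply]
      induction D.coact h with
      | zero => simp
      | add a b ha hb => simp only [map_add, ha, hb]
      | tmul g n => simp [G, Algebra.algebraMap_eq_smul_one]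
  apply LinearMap.ext
  intro x
  induction x using induction with
  | zero => simp
  | add x y hx hy => simp only [map_add, hx, hy]
  | tmul m h =>
    refine Eq.trans (congrArg Q (comul_tm D m h)) (Eq.trans ?_
      (congrArg (algebraMap k (Bicross D)) (counit_tm D m h)).symm)
    have e1 : ∀ t u, Q (Algebra.TensorProduct.map (incl D) (incl D) t * u) =
        LinearMap.mul' k _ (TensorProduct.map (LinearMap.mulRight k (Q u) ∘ₗ (incl D).toLinearMap)
          ((incl D).toLinearMap ∘ₗ HopfAlgebra.antipode k) t) := by
      intro t u
      induction t with
      | zero => simp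
      | add a b ha hb => simp only [map_add, add_mul, ha, hb]
      | tmul a b =>
        induction u with
        | zero => simp
        | add c d ha hb =>
          simp only [TensorProduct.map_tmul, LinearMap.comp_apply, LinearMap.mul'_apply,
            LinearMap.mulRight_apply, map_add, mul_add, add_mul] at ha hb ⊢
          rw [ha, hb]
        | tmul p q => simp [Q, antipodeMap_incl_mul, mul_assoc]
    have key := congrArg (incl D) (HopfAlgebra.mul_antipode_lTensor_comul_apply (R := k) m)
    have e2 : Q (comulIncl D m * comulPhi D h) = incl D (LinearMap.mul' k M
        ((HopfAlgebra.antipode k).lTensor M (Coalgebra.comul m))) *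
          algebraMap k _ (Coalgebra.counit h) := by
      rw [comulIncl, AlgHom.comp_apply, e1, h3, Bialgebra.comulAlgHom_apply]
      induction Coalgebra.comul (R := k) m with
      | zero => simp
      | add a b ha hb => simp only [map_add, add_mul, ha, hb]
      | tmul a b => simp [Algebra.algebraMap_eq_smul_one]
    rw [e2, key]
    simp

instance : HopfAlgebra k (Bicross D) where
  antipode := antipodeMap D
  mul_antipode_rTensor_comul := antipode_left_aux D
  mul_antipode_lTensor_comul := antipode_right_aux D

/-- The projection `π(m ⊗ h) = ε(m) h` of `M ▶◁ H` onto `H`. -/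
def proj : Bicross D →ₗ[k] H :=
  (TensorProduct.lid k H).toLinearMap ∘ₗ
    (Coalgebra.counit (R := k) (A := M)).rTensor H ∘ₗ (of D).symm.toLinearMap

/-- The right coaction `Δ_R = (id ⊗ π) ∘ Δ` of `H` on `M ▶◁ H`. -/
def deltaR : Bicross D →ₗ[k] Bicross D ⊗[k] H :=
  (proj D).lTensor (Bicross D) ∘ₗ Coalgebra.comul

end Bicross

section Calculus

variable (k A : Type*) [Field k] [Ring A]

/-- The universal one-forms `Ω¹A = ker(μ : A ⊗ A → A)`. The `A`-bimodule structure of `A ⊗ A` is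
`a · x · b = (a ⊗ 1) x (1 ⊗ b)`, with the product of the algebra `A ⊗ A`. -/
def Omega [Algebra k A] : Submodule k (A ⊗[k] A) := LinearMap.ker (LinearMap.mul' k A)

/-- `a ↦ a ⊗ 1` -/
def inl [Algebra k A] : A →ₗ[k] A ⊗[k] A :=
  (Algebra.TensorProduct.includeLeft : A →ₐ[k] A ⊗[k] A).toLinearMap

/-- `a ↦ 1 ⊗ a` -/
def inr [Algebra k A] : A →ₗ[k] A ⊗[k] A :=
  (Algebra.TensorProduct.includeRight : A →ₐ[k] A ⊗[k] A).toLinearMap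

/-- The universal differential `d_U a = 1 ⊗ a - a ⊗ 1`. -/
def dU [Algebra k A] : A →ₗ[k] A ⊗[k] A := inr k A - inl k A

theorem mul'_inl_mul [Algebra k A] (a : A) (x : A ⊗[k] A) :
    LinearMap.mul' k A (inl k A a * x) = a * LinearMap.mul' k A x := by
  induction x with
  | zero => simp
  | add x y hx hy => simp only [mul_add, map_add, hx, hy]
  | tmul b c => simp [inl, mul_assoc]

theorem mul'_mul_inr [Algebra k A] (a : A) (x : A ⊗[k] A) :
    LinearMap.mul' k A (x * inr k A a) = LinearMap.mul' k A x * a := by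
  induction x with
  | zero => simp
  | add x y hx hy => simp only [add_mul, map_add, hx, hy]
  | tmul b c => simp [inr, mul_assoc]

theorem mul'_dU [Algebra k A] (a : A) : LinearMap.mul' k A (dU k A a) = 0 := by
  simp [dU, inl, inr]

/-- The augmentation ideal `ker ε`. -/
abbrev kerEps [HopfAlgebra k A] : Submodule k A :=
  LinearMap.ker (Coalgebra.counit (R := k) (A := A))

/-- `π_ε(a) = a - ε(a) 1` -/
def piEps [HopfAlgebra k A] : A →ₗ[k] kerEps k A :=
  LinearMap.codRestrict (kerEps k A)
    (LinearMap.id - Algebra.linearMap k A ∘ₗ Coalgebra.counit) (by intro a; simp)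

theorem mul'_conv_inl {k A C : Type*} [Field k] [Ring A] [Algebra k A] [AddCommGroup C]
    [Module k C] [Coalgebra k C] (f : C →ₗ[k] A) (g : C →ₗ[k] A ⊗[k] A)
    (hg : ∀ c, LinearMap.mul' k A (g c) = 0) (c : C) :
    LinearMap.mul' k A (conv (inl k A ∘ₗ f) g c) = 0 := by
  rw [conv_apply]
  induction Coalgebra.comul (R := k) c with
  | zero => simp
  | add x y hx hy => simp only [map_add, hx, hy, add_zero]
  | tmul a b => simp [mul'_inl_mul, hg]

theorem mul'_conv_inr {k A C : Type*} [Field k] [Ring A] [Algebra k A] [AddCommGroup C]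
    [Module k C] [Coalgebra k C] (f : C →ₗ[k] A) (g : C →ₗ[k] A ⊗[k] A)
    (hg : ∀ c, LinearMap.mul' k A (g c) = 0) (c : C) :
    LinearMap.mul' k A (conv g (inr k A ∘ₗ f) c) = 0 := by
  rw [conv_apply]
  induction Coalgebra.comul (R := k) c with
  | zero => simp
  | add x y hx hy => simp only [map_add, hx, hy, add_zero]
  | tmul a b => simp [mul'_mul_inr, hg]

/-- `a ↦ S(a₁) d_U(a₂)` -/
def maurerCartan [HopfAlgebra k A] : A →ₗ[k] Omega k A :=
  LinearMap.codRestrict (Omega k A) (conv (inl k A ∘ₗ HopfAlgebra.antipode k) (dU k A))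
    (mul'_conv_inl _ _ (mul'_dU k A))

/-- The left regular coaction `Δ_L(u ⊗ v) = u₁ v₁ ⊗ (u₂ ⊗ v₂)` on `A ⊗ A`. -/
def deltaL [HopfAlgebra k A] : A ⊗[k] A →ₗ[k] A ⊗[k] (A ⊗[k] A) :=
  (LinearMap.mul' k A).rTensor (A ⊗[k] A) ∘ₗ Coalgebra.comul

/-- The right adjoint coaction `Ad(a) = a₂ ⊗ S(a₁) a₃`. -/
def Ad [HopfAlgebra k A] : A →ₗ[k] A ⊗[k] A :=
  (LinearMap.mul' k A ∘ₗ (HopfAlgebra.antipode k).rTensor A).lTensor A ∘ₗ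
    (TensorProduct.leftComm k A A A).toLinearMap ∘ₗ
    (Coalgebra.comul (R := k) (A := A)).lTensor A ∘ₗ Coalgebra.comul

/-- The restriction of `Ad` to a map `ker ε → ker ε ⊗ A` (`π_ε` is the identity on `ker ε`, and `Ad`
maps `ker ε` to `ker ε ⊗ A`). -/
def AdKer [HopfAlgebra k A] : kerEps k A →ₗ[k] kerEps k A ⊗[k] A :=
  (piEps k A).rTensor A ∘ₗ Ad k A ∘ₗ (kerEps k A).subtype

variable {k A}

/-- A map with values in universal one-forms is left-invariant if `Δ_L(f(v)) = 1 ⊗ f(v)`. -/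
def IsLeftInvariant [HopfAlgebra k A] {V : Type*} [AddCommGroup V] [Module k V]
    (f : V →ₗ[k] Omega k A) : Prop :=
  ∀ v, deltaL k A (f v) = (1 : A) ⊗ₜ[k] (f v : A ⊗[k] A)

end Calculus

section Bundle

variable {k P H : Type*} [Field k] [Ring P] [Algebra k P] [Ring H] [HopfAlgebra k H]
  (δ : P →ₗ[k] P ⊗[k] H)

/-- `χ(u ⊗ v) = u δ(v)` -/
def chi : P ⊗[k] P →ₗ[k] P ⊗[k] H :=
  (LinearMap.mul' k P).rTensor H ∘ₗ (TensorProduct.assoc k P P H).symm.toLinearMap ∘ₗ δ.lTensor P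

/-- The tensor product coaction `u ⊗ v ↦ (u₍₀₎ ⊗ v₍₀₎) ⊗ u₍₁₎ v₍₁₎` on `P ⊗ P`, where
`δ(u) = u₍₀₎ ⊗ u₍₁₎`. -/
def deltaR₂ : P ⊗[k] P →ₗ[k] (P ⊗[k] P) ⊗[k] H :=
  (LinearMap.mul' k H).lTensor (P ⊗[k] P) ∘ₗ
    (TensorProduct.tensorTensorTensorComm k P H P H).toLinearMap ∘ₗ TensorProduct.map δ δ

/-- The base `{u | δ(u) = u ⊗ 1}`. -/
def base : Submodule k P := LinearMap.eqLocus δ ((TensorProduct.mk k P H).flip 1)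

/-- The universal one-forms on the base, inside `P ⊗ P`. -/
def baseOmega : Submodule k (P ⊗[k] P) :=
  Omega k P ⊓ LinearMap.range (TensorProduct.mapIncl (base δ) (base δ))

/-- `(Ω¹B) P` for the base `B`. -/
def baseOmegaMul : Submodule k (P ⊗[k] P) :=
  Submodule.span k {y | ∃ x ∈ baseOmega δ, ∃ p : P, y = x * inr k P p}

/-- A connection on a bundle with universal calculus: `χ ∘ ω = 1 ⊗ id` and
`Δ_R ∘ ω = (ω ⊗ id) ∘ Ad`. -/
def IsConnection (ω : kerEps k H →ₗ[k] Omega k P) : Prop :=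
  (∀ h, chi δ (ω h) = (1 : P) ⊗ₜ[k] (h : H)) ∧
  (∀ h, deltaR₂ δ (ω h) = ((Omega k P).subtype ∘ₗ ω).rTensor H (AdKer k H h))

/-- The projection `Π = · ∘ (id ⊗ ω) ∘ χ` of a connection, that is
`Π(u d_U v) = u v₍₀₎ ω(π_ε(v₍₁₎))`. It is the projection on `Ω¹P`, where `χ` takes values in
`P ⊗ ker ε`. -/
def connProj (ω : kerEps k H →ₗ[k] Omega k P) : P ⊗[k] P →ₗ[k] P ⊗[k] P :=
  LinearMap.mul' k (P ⊗[k] P) ∘ₗ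
    TensorProduct.map (inl k P) ((Omega k P).subtype ∘ₗ ω ∘ₗ piEps k H) ∘ₗ chi δ

/-- A connection is strong if `(id - Π)(d_U P) ⊆ (Ω¹B) P` for the base `B`. -/
def IsStrong (ω : kerEps k H →ₗ[k] Omega k P) : Prop :=
  ∀ u, dU k P u - connProj δ ω (dU k P u) ∈ baseOmegaMul δ

end Bundle

section Splitting

variable {k P H : Type*} [Field k] [Ring P] [HopfAlgebra k P] [Ring H] [HopfAlgebra k H]

/-- A splitting of `π : P → H`: `π ∘ i = id` and `(id ⊗ π) ∘ Ad ∘ i = (i ⊗ id) ∘ Ad`. -/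
def IsSplitting (π : P →ₗ[k] H) (i : kerEps k H →ₗ[k] kerEps k P) : Prop :=
  (∀ h, π (i h) = h) ∧
  (∀ h, π.lTensor P (Ad k P (i h)) =
    ((kerEps k P).subtype ∘ₗ i).rTensor H (AdKer k H h))

/-- The canonical connection `h ↦ S(i(h)₁) d_U(i(h)₂)` of a splitting `i`. -/
def canonicalConnection (i : kerEps k H →ₗ[k] kerEps k P) : kerEps k H →ₗ[k] Omega k P :=
  maurerCartan k P ∘ₗ (kerEps k P).subtype ∘ₗ i

end Splitting

section Main

variable {k M H : Type*} [Field k] [Ring M] [Ring H] [HopfAlgebra k M] [HopfAlgebra k H]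

namespace Bicross

variable (D : MatchedPair k M H)

/-- `β_U ∘ π_ε`, with `Ω¹M` regarded inside `(M ▶◁ H) ⊗ (M ▶◁ H)`. -/
def betaP (β : kerEps k H →ₗ[k] Omega k M) : H →ₗ[k] Bicross D ⊗[k] Bicross D :=
  TensorProduct.map (incl D).toLinearMap (incl D).toLinearMap ∘ₗ (Omega k M).subtype ∘ₗ
    β ∘ₗ piEps k H

theorem mul'_betaP (β : kerEps k H →ₗ[k] Omega k M) (h : H) :
    LinearMap.mul' k (Bicross D) (betaP D β h) = 0 := by
  have h1 : ∀ x : M ⊗[k] M, LinearMap.mul' k (Bicross D)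
      (TensorProduct.map (incl D).toLinearMap (incl D).toLinearMap x) =
        incl D (LinearMap.mul' k M x) := by
    intro x
    induction x with
    | zero => simp
    | add x y hx hy => simp only [map_add, hx, hy]
    | tmul a b => simp
  have h2 : LinearMap.mul' k M (β (piEps k H h)) = 0 := (β (piEps k H h)).2
  simp [betaP, h1, h2]

/-- The connection `ω_U(h) = Φ⁻¹(h₁) β_U(π_ε(h₂)) Φ(h₃) + Φ⁻¹(h₁) d_U Φ(h₂)` on the trivial bundle
`M ▶◁ H`, where `Φ⁻¹ = Φ ∘ S`. -/
def connectionOfBeta (β : kerEps k H →ₗ[k] Omega k M) :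
    kerEps k H →ₗ[k] Omega k (Bicross D) :=
  LinearMap.codRestrict (Omega k (Bicross D))
    (conv (inl k (Bicross D) ∘ₗ (Phi D).toLinearMap ∘ₗ HopfAlgebra.antipode k)
        (conv (betaP D β) (inr k (Bicross D) ∘ₗ (Phi D).toLinearMap)) +
      conv (inl k (Bicross D) ∘ₗ (Phi D).toLinearMap ∘ₗ HopfAlgebra.antipode k)
        (dU k (Bicross D) ∘ₗ (Phi D).toLinearMap)) (by
      intro h
      have h1 := mul'_conv_inl ((Phi D).toLinearMap ∘ₗ HopfAlgebra.antipode k) _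
        (mul'_conv_inr (Phi D).toLinearMap _ (mul'_betaP D β)) h
      have h2 := mul'_conv_inl ((Phi D).toLinearMap ∘ₗ HopfAlgebra.antipode k)
        (dU k (Bicross D) ∘ₗ (Phi D).toLinearMap) (fun c => mul'_dU k _ _) h
      rw [Omega, LinearMap.mem_ker, LinearMap.add_apply, map_add, h1, h2, add_zero]) ∘ₗ
    (kerEps k H).subtype

/-- The compatibility of `β_U` with the coaction,
`β_U(π_ε(h₁)) h₂⁽²⁾ ⊗ h₂⁽¹⁾ - h₁⁽²⁾ β_U(π_ε(h₂)) ⊗ h₁⁽¹⁾ = - d_U h⁽²⁾ ⊗ h⁽¹⁾` for all `h`, an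
equation in `(M ⊗ M) ⊗ H`, in which the two terms on the left are convolution products. -/
def BetaCompatible (β : kerEps k H →ₗ[k] Omega k M) : Prop :=
  let b : H →ₗ[k] (M ⊗[k] M) ⊗[k] H :=
    (Algebra.TensorProduct.includeLeft : M ⊗[k] M →ₐ[k] (M ⊗[k] M) ⊗[k] H).toLinearMap ∘ₗ
      (Omega k M).subtype ∘ₗ β ∘ₗ piEps k H
  let c : H →ₗ[k] M ⊗[k] H := (TensorProduct.comm k H M).toLinearMap ∘ₗ D.coact
  conv b ((inr k M).rTensor H ∘ₗ c) - conv ((inl k M).rTensor H ∘ₗ c) b =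
    -((dU k M).rTensor H ∘ₗ c)

/-- The compatibility of `γ` with the coaction,
`γ(h₁) h₂⁽²⁾ ⊗ h₂⁽¹⁾ = γ(h₂) ⊗ h₁` for all `h`. -/
def GammaCompatible (γ : H →ₗ[k] M) : Prop :=
  conv ((Algebra.TensorProduct.includeLeft : M →ₐ[k] M ⊗[k] H).toLinearMap ∘ₗ γ)
      ((TensorProduct.comm k H M).toLinearMap ∘ₗ D.coact) =
    γ.rTensor H ∘ₗ (TensorProduct.comm k H H).toLinearMap ∘ₗ Coalgebra.comul

/-- The strong left-invariant connections on `M ▶◁ H`. -/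
def strongInvariantConnections : Set (kerEps k H →ₗ[k] Omega k (Bicross D)) :=
  {ω | IsConnection (deltaR D) ω ∧ IsStrong (deltaR D) ω ∧ IsLeftInvariant ω}

/-- The left-invariant maps `β_U : ker ε → Ω¹M` that are compatible with the coaction. -/
def admissibleBetas : Set (kerEps k H →ₗ[k] Omega k M) :=
  {β | IsLeftInvariant β ∧ BetaCompatible D β}

/-- The linear maps `γ : H → M` with `γ(1) = 1` and `ε ∘ γ = ε` that are compatible with the
coaction. -/
def admissibleGammas : Set (H →ₗ[k] M) :=
  {γ | γ 1 = 1 ∧ (∀ h, Coalgebra.counit (R := k) (γ h) = Coalgebra.counit (R := k) h) ∧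
    GammaCompatible D γ}

/-- `β_U(h) = S(γ(h)₁) d_U(γ(h)₂)` for `h ∈ ker ε` -/
def betaOfGamma (γ : H →ₗ[k] M) : kerEps k H →ₗ[k] Omega k M :=
  maurerCartan k M ∘ₗ γ ∘ₗ (kerEps k H).subtype

/-- `i(h) = γ(h₁) ⊗ h₂` -/
def splittingOfGamma (γ : H →ₗ[k] M) : H →ₗ[k] Bicross D :=
  (of D).toLinearMap ∘ₗ γ.rTensor H ∘ₗ Coalgebra.comul

end Bicross

end Main

end QPB

end

/-! Everything takes place in convolution algebras of linear maps out of `H`, and the device that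
makes it work is to replace a form-valued map `f` on `ker ε` by `F = f ∘ π_ε + ε 1` on all of `H`
(`extendUnit`). Such `F` are exactly the linear maps with `F(1) = 1` and `μ ∘ F = ε`. Inhomogeneous
formulas then become multiplicative. With `W` and `B` the extensions of `ω_U` and `β_U`, the
defining formula of `ω_U` reads `W = (Φ⁻¹ ⊗ 1) * B * (1 ⊗ Φ)`, a product with convolution-invertible
outer factors (`extendUnit_connectionOfBeta`); and the compatibility of `β_U` loses its `d_U` term
(`betaCompatible_iff`).

Each condition on `W` is transported to `B` by cancelling invertible factors. `Ad`-equivariance of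
`W` means that `B` is `Δ_R`-invariant (`equivariant_iff`). Strength puts `B` in `M ⊗ P`, and
invariance then forces it into `M ⊗ M` (`inclIncl_of_mem_leftBase`). So, before left-invariance is
considered, all maps `β_U` correspond bijectively to all strong connections. Left-invariance of `W`
becomes an identity that relates `Δ_L B` to the coaction (`leftInvariant_conv_iff`). Projecting its
first tensor leg to `M` gives left-invariance of `B`, and what remains is the compatibility
condition (`isLeftInvariant_connectionOfBeta_iff`).

For the second bijection, the left-invariant elements of `A ⊗ A` are exactly the `S(a₁) ⊗ a₂`, and
`ε ⊗ id` recovers `a` (`deltaL_leftInv`, `leftInv_counitLeft`). Hence `B(h) = S(γ(h)₁) ⊗ γ(h)₂` with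
`γ = (ε ⊗ id) ∘ B`, and coassociativity of the coaction translates one compatibility condition into
the other (`gammaCompatible_iff`).

The third claim uses the same fact in `P`. The map `W` is left-invariant and `(ε ⊗ id) ∘ W = γ * Φ =
i`, so `W(h) = S(i(h)₁) ⊗ i(h)₂`, which is the canonical connection on `ker ε`. Equivariance of `i`
is the image under `ε ⊗ id` of equivariance of `W`. -/

noncomputable section

namespace QPB

/-! ### The convolution algebra and cancellation in it. -/

section Convolution

variable {k C A B : Type*} [CommSemiring k] [AddCommMonoid C] [Module k C] [Coalgebra k C]

section Semiring

variable [Semiring A] [Algebra k A] [Semiring B] [Algebra k B]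

variable (k C A) in
/-- The unit `c ↦ ε(c) 1` of the convolution product. -/
def convUnit : C →ₗ[k] A := Algebra.linearMap k A ∘ₗ Coalgebra.counit

theorem convUnit_apply (c : C) : convUnit k C A c = algebraMap k A (Coalgebra.counit c) := rfl

theorem conv_convUnit (f : C →ₗ[k] A) : conv f (convUnit k C A) = f :=
  congrArg WithConv.ofConv (mul_one (WithConv.toConv f))

theorem convUnit_conv (f : C →ₗ[k] A) : conv (convUnit k C A) f = f :=
  congrArg WithConv.ofConv (one_mul (WithConv.toConv f))

theorem conv_add (f g h : C →ₗ[k] A) : conv f (g + h) = conv f g + conv f h :=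
  congrArg WithConv.ofConv
    (mul_add (WithConv.toConv f) (WithConv.toConv g) (WithConv.toConv h))

theorem add_conv (f g h : C →ₗ[k] A) : conv (f + g) h = conv f h + conv g h :=
  congrArg WithConv.ofConv
    (add_mul (WithConv.toConv f) (WithConv.toConv g) (WithConv.toConv h))

theorem algHom_comp_convUnit (φ : A →ₐ[k] B) :
    φ.toLinearMap ∘ₗ convUnit k C A = convUnit k C B := by
  ext c
  simp [convUnit]

/-- A linear map that intertwines two-sided multiplication intertwines convolution. -/
theorem comp_conv_conv (Ψ : A →ₗ[k] B) (f f' g : C →ₗ[k] A) (l r : C →ₗ[k] B)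
    (h : ∀ c x d, Ψ (f c * (x * f' d)) = l c * (Ψ x * r d)) :
    Ψ ∘ₗ conv f (conv g f') = conv l (conv (Ψ ∘ₗ g) r) := by
  ext c
  simp only [LinearMap.comp_apply, conv_apply f, conv_apply l]
  induction Coalgebra.comul (R := k) c with
  | zero => simp
  | add a b ha hb => simp only [map_add, ha, hb]
  | tmul a b =>
    simp only [TensorProduct.map_tmul, LinearMap.mul'_apply, conv_apply]
    induction Coalgebra.comul (R := k) b with
    | zero => simp
    | add a b ha hb => simp only [map_add, mul_add, ha, hb]
    | tmul x y => simp [h]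

theorem comp_conv_of_left (Ψ : A →ₗ[k] B) (f g : C →ₗ[k] A) (l : C →ₗ[k] B)
    (h : ∀ c d, Ψ (f c * g d) = l c * Ψ (g d)) :
    Ψ ∘ₗ conv f g = conv l (Ψ ∘ₗ g) := by
  ext c
  simp only [LinearMap.comp_apply, conv_apply]
  induction Coalgebra.comul (R := k) c with
  | zero => simp
  | add a b ha hb => simp only [map_add, ha, hb]
  | tmul a b => simp [h]

theorem comp_conv_of_right (Ψ : A →ₗ[k] B) (f g : C →ₗ[k] A) (r : C →ₗ[k] B)
    (h : ∀ c d, Ψ (f c * g d) = Ψ (f c) * r d) :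
    Ψ ∘ₗ conv f g = conv (Ψ ∘ₗ f) r := by
  ext c
  simp only [LinearMap.comp_apply, conv_apply]
  induction Coalgebra.comul (R := k) c with
  | zero => simp
  | add a b ha hb => simp only [map_add, ha, hb]
  | tmul a b => simp [h]

theorem conv_left_cancel {f f' g h : C →ₗ[k] A} (hf : conv f' f = convUnit k C A)
    (e : conv f g = conv f h) : g = h := by
  rw [← convUnit_conv g, ← convUnit_conv h, ← hf, conv_assoc, conv_assoc, e]

theorem conv_right_cancel {f f' g h : C →ₗ[k] A} (hf : conv f f' = convUnit k C A)
    (e : conv g f = conv h f) : g = h := by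
  rw [← conv_convUnit g, ← conv_convUnit h, ← hf, ← conv_assoc, ← conv_assoc, e]

end Semiring

theorem conv_sub [Ring A] [Algebra k A] (f g h : C →ₗ[k] A) :
    conv f (g - h) = conv f g - conv f h :=
  congrArg WithConv.ofConv
    (mul_sub (WithConv.toConv f) (WithConv.toConv g) (WithConv.toConv h))

end Convolution

/-! ### Convolution inverses of algebra maps. -/

section AntipodeConvolution

variable {k H A : Type*} [CommSemiring k] [Semiring H] [HopfAlgebra k H] [Semiring A]
  [Algebra k A]

theorem conv_antipode (φ : H →ₐ[k] A) :
    conv φ.toLinearMap (φ.toLinearMap ∘ₗ HopfAlgebra.antipode k) = convUnit k H A := by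
  have h : conv LinearMap.id (HopfAlgebra.antipode k) = convUnit k H H :=
    congrArg WithConv.ofConv (LinearMap.id_mul_antipode (R := k) (C := H))
  rw [← algHom_comp_convUnit φ, ← h, algHom_comp_conv, LinearMap.comp_id]

theorem antipode_conv (φ : H →ₐ[k] A) :
    conv (φ.toLinearMap ∘ₗ HopfAlgebra.antipode k) φ.toLinearMap = convUnit k H A := by
  have h : conv (HopfAlgebra.antipode k) LinearMap.id = convUnit k H H :=
    congrArg WithConv.ofConv (LinearMap.antipode_mul_id (R := k) (C := H))
  rw [← algHom_comp_convUnit φ, ← h, algHom_comp_conv, LinearMap.comp_id]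

theorem conv_one_apply (f g : H →ₗ[k] A) : conv f g 1 = f 1 * g 1 := by
  rw [conv_apply, Bialgebra.comul_one, Algebra.TensorProduct.one_def]
  simp

end AntipodeConvolution

/-! ### Universal one-forms and left-invariant tensors. -/

section Forms

variable {k A : Type*} [Field k] [Ring A]

theorem inl_apply [Algebra k A] (a : A) : inl k A a = a ⊗ₜ 1 := rfl

theorem inr_apply [Algebra k A] (a : A) : inr k A a = 1 ⊗ₜ a := rfl

theorem mul'_of_mem_Omega [Algebra k A] (x : Omega k A) :
    LinearMap.mul' k A (x : A ⊗[k] A) = 0 := x.2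

variable [HopfAlgebra k A]

theorem piEps_coe (a : A) : (piEps k A a : A) = a - algebraMap k A (Coalgebra.counit a) := rfl

theorem piEps_of_mem (a : kerEps k A) : piEps k A a = a := by
  have h : Coalgebra.counit (R := k) (a : A) = 0 := a.2
  apply Subtype.ext
  rw [piEps_coe, h, map_zero, sub_zero]

theorem piEps_one : piEps k A 1 = 0 := by
  apply Subtype.ext
  simp [piEps_coe]

/-- A linear map on `ker ε` with values in one-forms, extended to `h ↦ f(π_ε(h)) + ε(h) 1`. -/
def extendUnit {B : Type*} [Ring B] [Algebra k B] (f : kerEps k A →ₗ[k] Omega k B) :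
    A →ₗ[k] B ⊗[k] B :=
  (Omega k B).subtype ∘ₗ f ∘ₗ piEps k A + convUnit k A (B ⊗[k] B)

section extendUnit

variable {B : Type*} [Ring B] [Algebra k B]

theorem extendUnit_apply (f : kerEps k A →ₗ[k] Omega k B) (a : A) :
    extendUnit f a = f (piEps k A a) + algebraMap k (B ⊗[k] B) (Coalgebra.counit a) := rfl

theorem extendUnit_coe (f : kerEps k A →ₗ[k] Omega k B) (a : kerEps k A) :
    extendUnit f a = f a := by
  have h : Coalgebra.counit (R := k) (a : A) = 0 := a.2
  rw [extendUnit_apply, piEps_of_mem, h, map_zero, add_zero]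

theorem extendUnit_one (f : kerEps k A →ₗ[k] Omega k B) : extendUnit f 1 = 1 := by
  rw [extendUnit_apply, piEps_one]
  simp [Algebra.TensorProduct.one_def]

theorem mul'_comp_extendUnit (f : kerEps k A →ₗ[k] Omega k B) :
    LinearMap.mul' k B ∘ₗ extendUnit f = convUnit k A B := by
  ext a
  rw [LinearMap.comp_apply, extendUnit_apply, map_add, mul'_of_mem_Omega, zero_add,
    convUnit_apply, Algebra.algebraMap_eq_smul_one, map_smul, Algebra.TensorProduct.one_def,
    LinearMap.mul'_apply, mul_one, Algebra.algebraMap_eq_smul_one]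

theorem extendUnit_injective :
    Function.Injective (extendUnit : (kerEps k A →ₗ[k] Omega k B) → (A →ₗ[k] B ⊗[k] B)) := by
  intro f g h
  ext a
  rw [← extendUnit_coe, ← extendUnit_coe, h]

/-- Since `A = ker ε ⊕ k 1`, the value at `1` fixes the scalar part, while `μ ∘ F = ε` says that
`ker ε` is sent into `ker μ`. -/
theorem exists_extendUnit {F : A →ₗ[k] B ⊗[k] B} (h1 : F 1 = 1)
    (hF : LinearMap.mul' k B ∘ₗ F = convUnit k A B) :
    ∃ f : kerEps k A →ₗ[k] Omega k B, extendUnit f = F := by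
  refine ⟨LinearMap.codRestrict (Omega k B) (F ∘ₗ (kerEps k A).subtype) fun a => ?_, ?_⟩
  · have h : Coalgebra.counit (R := k) (a : A) = 0 := a.2
    have := LinearMap.congr_fun hF a
    rw [convUnit_apply, h, map_zero] at this
    exact this
  · ext a
    have e : F (piEps k A a) + algebraMap k (B ⊗[k] B) (Coalgebra.counit a) = F a := by
      rw [piEps_coe, map_sub, Algebra.algebraMap_eq_smul_one, map_smul, h1,
        Algebra.algebraMap_eq_smul_one, sub_add_cancel]
    exact e

end extendUnit

/-! ### The left regular coaction -/

variable (k A) in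
/-- `a ↦ a₁ ⊗ (a₂ ⊗ 1)` -/
def comulInl : A →ₐ[k] A ⊗[k] (A ⊗[k] A) :=
  (Algebra.TensorProduct.map (.id k A) Algebra.TensorProduct.includeLeft).comp
    (Bialgebra.comulAlgHom k A)

variable (k A) in
/-- `a ↦ a₁ ⊗ (1 ⊗ a₂)` -/
def comulInr : A →ₐ[k] A ⊗[k] (A ⊗[k] A) :=
  (Algebra.TensorProduct.map (.id k A) Algebra.TensorProduct.includeRight).comp
    (Bialgebra.comulAlgHom k A)

/-- Factoring `Δ_L` through two algebra maps makes it compatible with outer multiplications, so that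
`comp_conv_conv` applies to it. -/
theorem deltaL_tmul (a b : A) : deltaL k A (a ⊗ₜ b) = comulInl k A a * comulInr k A b := by
  simp only [deltaL, LinearMap.comp_apply, comulInl, comulInr, AlgHom.comp_apply,
    Bialgebra.comulAlgHom_apply, TensorProduct.comul_tmul]
  induction Coalgebra.comul (R := k) a with
  | zero => simp
  | add x y hx hy => simp only [TensorProduct.add_tmul, map_add, add_mul, hx, hy]
  | tmul x y =>
    induction Coalgebra.comul (R := k) b with
    | zero => simp
    | add x y hx hy => simp only [TensorProduct.tmul_add, map_add, mul_add, hx, hy]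
    | tmul z w => simp

theorem deltaL_inl_mul_inr (a b : A) (x : A ⊗[k] A) :
    deltaL k A (inl k A a * (x * inr k A b)) =
      comulInl k A a * (deltaL k A x * comulInr k A b) := by
  induction x with
  | zero => simp
  | add x y hx hy => simp only [add_mul, mul_add, map_add, hx, hy]
  | tmul c d => simp [inl_apply, inr_apply, deltaL_tmul, mul_assoc]

theorem deltaL_one : deltaL k A 1 = 1 := by
  rw [Algebra.TensorProduct.one_def, deltaL_tmul, map_one, map_one, one_mul]

variable (k A) in
/-- `x ↦ 1 ⊗ x` -/
def oneTmul : A ⊗[k] A →ₐ[k] A ⊗[k] (A ⊗[k] A) := Algebra.TensorProduct.includeRight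

theorem oneTmul_apply (x : A ⊗[k] A) : oneTmul k A x = 1 ⊗ₜ x := rfl

/-- The added term `ε 1` does not matter because `1 ⊗ 1` is itself left-invariant. -/
theorem isLeftInvariant_iff {B : Type*} [Ring B] [HopfAlgebra k B]
    (f : kerEps k A →ₗ[k] Omega k B) :
    IsLeftInvariant f ↔
      deltaL k B ∘ₗ extendUnit f = (oneTmul k B).toLinearMap ∘ₗ extendUnit f := by
  constructor
  · intro h
    ext a
    rw [LinearMap.comp_apply, LinearMap.comp_apply, extendUnit_apply, map_add, h,
      Algebra.algebraMap_eq_smul_one, map_smul, deltaL_one, map_add, map_smul]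
    simp [oneTmul_apply, Algebra.TensorProduct.one_def]
  · intro h a
    have := LinearMap.congr_fun h a
    rwa [LinearMap.comp_apply, LinearMap.comp_apply, extendUnit_coe] at this

/-- `a ↦ S(a₁) ⊗ a₂` -/
def leftInv (k A : Type*) [Field k] [Ring A] [HopfAlgebra k A] : A →ₗ[k] A ⊗[k] A :=
  (HopfAlgebra.antipode k).rTensor A ∘ₗ Coalgebra.comul

theorem leftInv_eq_conv : leftInv k A =
    conv (inl k A ∘ₗ HopfAlgebra.antipode k) (inr k A) := by
  ext a
  simp only [leftInv, LinearMap.comp_apply, conv_apply]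
  induction Coalgebra.comul (R := k) a with
  | zero => simp
  | add x y hx hy => simp only [map_add, hx, hy]
  | tmul x y => simp [inl_apply, inr_apply]

variable (k A) in
/-- `u ⊗ v ↦ ε(u) v` -/
def counitLeft : A ⊗[k] A →ₗ[k] A :=
  (TensorProduct.lid k A).toLinearMap ∘ₗ (Coalgebra.counit (R := k) (A := A)).rTensor A

theorem counitLeft_tmul (a b : A) :
    counitLeft k A (a ⊗ₜ b) = Coalgebra.counit (R := k) a • b := by
  simp [counitLeft]

/-- This retraction is how `γ` is recovered from `β_U`. -/
theorem counitLeft_leftInv (a : A) : counitLeft k A (leftInv k A a) = a := by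
  have h := congrArg (TensorProduct.lid k A) (Coalgebra.rTensor_counit_comul (R := k) a)
  rw [TensorProduct.lid_tmul, one_smul] at h
  refine Eq.trans ?_ h
  simp only [counitLeft, leftInv, LinearMap.comp_apply]
  induction Coalgebra.comul (R := k) a with
  | zero => simp
  | add x y hx hy => simp only [map_add, hx, hy]
  | tmul x y => simp

/-- The counit axiom collapses the coproduct of `a`. What is left is the Galois map `a ⊗ b ↦ a b₁ ⊗
b₂`, which the antipode inverts. -/
theorem lTensor_counitLeft_deltaL (a b : A) :
    (counitLeft k A).lTensor A (deltaL k A (a ⊗ₜ b)) = inl k A a * Coalgebra.comul b := by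
  have h := congrArg (TensorProduct.rid k A) (Coalgebra.lTensor_counit_comul (R := k) a)
  rw [TensorProduct.rid_tmul, one_smul] at h
  conv_rhs => rw [← h]
  simp only [deltaL, LinearMap.comp_apply, TensorProduct.comul_tmul]
  induction Coalgebra.comul (R := k) a with
  | zero => simp
  | add x y hx hy => simp only [TensorProduct.add_tmul, map_add, add_mul, hx, hy]
  | tmul x y =>
    induction Coalgebra.comul (R := k) b with
    | zero => simp
    | add x y hx hy => simp only [TensorProduct.tmul_add, map_add, mul_add, hx, hy]
    | tmul z w => simp [inl_apply, counitLeft_tmul, TensorProduct.smul_tmul']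

/-- Left-invariant elements of `A ⊗ A` have the form `S(a₁) ⊗ a₂`. -/
theorem leftInv_counitLeft {x : A ⊗[k] A} (hx : deltaL k A x = 1 ⊗ₜ x) :
    leftInv k A (counitLeft k A x) = x := by
  -- The inverse Galois map `u ⊗ v ↦ u S(v₁) ⊗ v₂`. It undoes `(id ⊗ (ε ⊗ id)) ∘ Δ_L`, and for
  -- invariant `x` it is evaluated at `1 ⊗ (ε ⊗ id)(x)`.
  let κ : A ⊗[k] A →ₗ[k] A ⊗[k] A :=
    LinearMap.mul' k (A ⊗[k] A) ∘ₗ TensorProduct.map (inl k A) (leftInv k A)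
  have h1 : conv (inl k A) (leftInv k A) = inr k A := by
    have := conv_antipode (Algebra.TensorProduct.includeLeft : A →ₐ[k] A ⊗[k] A)
    rw [leftInv_eq_conv, ← conv_assoc]
    exact (congrArg (fun f => conv f (inr k A)) this).trans (convUnit_conv _)
  have h2 : ∀ a t, κ (inl k A a * t) = inl k A a * κ t := by
    intro a t
    induction t with
    | zero => simp
    | add x y hx hy => simp only [mul_add, map_add, hx, hy]
    | tmul b c => simp [κ, inl_apply, ← mul_assoc]
  have h3 : ∀ y, κ ((counitLeft k A).lTensor A (deltaL k A y)) = y := by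
    intro y
    induction y with
    | zero => simp
    | add x y hx hy => simp only [map_add, hx, hy]
    | tmul a b =>
      have h4 : κ (Coalgebra.comul b) = inr k A b := LinearMap.congr_fun h1 b
      rw [lTensor_counitLeft_deltaL, h2, h4]
      simp [inl_apply, inr_apply]
  have h5 := h3 x
  rw [hx] at h5
  refine Eq.trans ?_ h5
  simp [κ, inl_apply, ← Algebra.TensorProduct.one_def]

theorem mul'_leftInv (a : A) :
    LinearMap.mul' k A (leftInv k A a) = algebraMap k A (Coalgebra.counit a) :=
  HopfAlgebra.mul_antipode_rTensor_comul_apply a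

theorem comulInl_eq_conv : (comulInl k A).toLinearMap =
    conv (Algebra.TensorProduct.includeLeft : A →ₐ[k] A ⊗[k] (A ⊗[k] A)).toLinearMap
      ((oneTmul k A).comp Algebra.TensorProduct.includeLeft).toLinearMap := by
  ext a
  simp only [conv_apply, comulInl, AlgHom.toLinearMap_apply, AlgHom.comp_apply,
    Bialgebra.comulAlgHom_apply]
  induction Coalgebra.comul (R := k) a with
  | zero => simp
  | add x y hx hy => simp only [map_add, hx, hy]
  | tmul x y => simp [oneTmul_apply]

theorem comulInr_eq_conv : (comulInr k A).toLinearMap =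
    conv (Algebra.TensorProduct.includeLeft : A →ₐ[k] A ⊗[k] (A ⊗[k] A)).toLinearMap
      ((oneTmul k A).comp Algebra.TensorProduct.includeRight).toLinearMap := by
  ext a
  simp only [conv_apply, comulInr, AlgHom.toLinearMap_apply, AlgHom.comp_apply,
    Bialgebra.comulAlgHom_apply]
  induction Coalgebra.comul (R := k) a with
  | zero => simp
  | add x y hx hy => simp only [map_add, hx, hy]
  | tmul x y => simp [oneTmul_apply]

/-- Uniqueness of convolution inverses replaces a formula for `Δ ∘ S`. From `comulInl = τ * l` it
follows that `(comulInl ∘ S) * τ = l ∘ S`, so the factor `τ` in `comulInr = τ * r` is absorbed. -/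
theorem deltaL_leftInv (a : A) : deltaL k A (leftInv k A a) = 1 ⊗ₜ leftInv k A a := by
  set τ := (Algebra.TensorProduct.includeLeft : A →ₐ[k] A ⊗[k] (A ⊗[k] A)).toLinearMap
  set l := (oneTmul k A).comp (Algebra.TensorProduct.includeLeft : A →ₐ[k] A ⊗[k] A)
  set r := (oneTmul k A).comp (Algebra.TensorProduct.includeRight : A →ₐ[k] A ⊗[k] A)
  have h1 : deltaL k A ∘ₗ leftInv k A =
      conv ((comulInl k A).toLinearMap ∘ₗ HopfAlgebra.antipode k) (comulInr k A).toLinearMap := by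
    ext a
    simp only [leftInv, LinearMap.comp_apply, conv_apply]
    induction Coalgebra.comul (R := k) a with
    | zero => simp
    | add x y hx hy => simp only [map_add, hx, hy]
    | tmul x y => simp [deltaL_tmul]
  have h2 : conv ((comulInl k A).toLinearMap ∘ₗ HopfAlgebra.antipode k) τ =
      l.toLinearMap ∘ₗ HopfAlgebra.antipode k := by
    apply conv_right_cancel (conv_antipode l)
    rw [conv_assoc, ← comulInl_eq_conv, antipode_conv, antipode_conv]
  have h3 : (oneTmul k A).toLinearMap ∘ₗ leftInv k A =
      conv (l.toLinearMap ∘ₗ HopfAlgebra.antipode k) r.toLinearMap := by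
    rw [leftInv_eq_conv, algHom_comp_conv]
    rfl
  rw [comulInr_eq_conv, ← conv_assoc, h2, ← h3] at h1
  exact LinearMap.congr_fun h1 a

/-- The term `S(a₁) a₂ ⊗ 1` of the differential collapses to `ε(a)`; on `ker ε` the Maurer–Cartan
form is therefore `S(a₁) ⊗ a₂`. -/
theorem maurerCartan_coe (a : A) : (maurerCartan k A a : A ⊗[k] A) =
    leftInv k A a - algebraMap k (A ⊗[k] A) (Coalgebra.counit a) := by
  have h : conv (inl k A ∘ₗ HopfAlgebra.antipode k) (dU k A) =
      leftInv k A - convUnit k A (A ⊗[k] A) := by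
    have := antipode_conv (Algebra.TensorProduct.includeLeft : A →ₐ[k] A ⊗[k] A)
    rw [dU, conv_sub, ← leftInv_eq_conv]
    exact congrArg _ this
  exact LinearMap.congr_fun h a

end Forms

/-! ### The adjoint coaction as a convolution product. -/

section AdjointCoaction

variable {k A X : Type*} [Field k] [Ring A] [HopfAlgebra k A] [Ring X] [Algebra k X]

/-- `f(a₂) ⊗ S(a₁) a₃` as a convolution product in `X ⊗ A`. -/
theorem rTensor_comp_Ad (f : A →ₗ[k] X) : f.rTensor A ∘ₗ Ad k A =
    conv ((Algebra.TensorProduct.includeRight : A →ₐ[k] X ⊗[k] A).toLinearMap ∘ₗ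
        HopfAlgebra.antipode k)
      (conv ((Algebra.TensorProduct.includeLeft : X →ₐ[k] X ⊗[k] A).toLinearMap ∘ₗ f)
        (Algebra.TensorProduct.includeRight : A →ₐ[k] X ⊗[k] A).toLinearMap) := by
  ext a
  simp only [LinearMap.comp_apply, Ad]
  rw [conv_apply]
  induction Coalgebra.comul (R := k) a with
  | zero => simp
  | add x y hx hy => simp only [map_add, hx, hy]
  | tmul x y =>
    simp only [TensorProduct.map_tmul, LinearMap.mul'_apply, LinearMap.lTensor_tmul]
    rw [conv_apply]
    induction Coalgebra.comul (R := k) y with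
    | zero => simp
    | add x y hx hy => simp only [map_add, TensorProduct.tmul_add, mul_add, hx, hy]
    | tmul z w => simp

/-- `Ad` restricted to `ker ε` may be computed with any extension of a map that preserves `1`. -/
theorem rTensor_AdKer (F : A →ₗ[k] X) (hF : F 1 = 1) (a : kerEps k A) :
    (F ∘ₗ (kerEps k A).subtype).rTensor A (AdKer k A a) = F.rTensor A (Ad k A a) := by
  have h1 : F ∘ₗ (kerEps k A).subtype ∘ₗ piEps k A = F - convUnit k A X := by
    ext b
    have e : F (piEps k A b : A) = F b - convUnit k A X b := by
      rw [piEps_coe, map_sub, Algebra.algebraMap_eq_smul_one, map_smul, hF, convUnit_apply,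
        Algebra.algebraMap_eq_smul_one]
    exact e
  -- The scalar part contributes `ε(a₂) S(a₁) a₃ = ε(a) 1`, which vanishes on `ker ε`.
  have h2 : (convUnit k A X).rTensor A (Ad k A a) = 0 := by
    have h : Coalgebra.counit (R := k) (a : A) = 0 := a.2
    have := LinearMap.congr_fun (rTensor_comp_Ad (convUnit k A X)) a
    rw [algHom_comp_convUnit, convUnit_conv, antipode_conv, convUnit_apply, h, map_zero] at this
    exact this
  have h3 : (F ∘ₗ (kerEps k A).subtype).rTensor A (AdKer k A a) =
      (F ∘ₗ (kerEps k A).subtype ∘ₗ piEps k A).rTensor A (Ad k A a) := by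
    rw [← LinearMap.comp_assoc, LinearMap.rTensor_comp_apply _ _ (piEps k A)]
    rfl
  rw [h3, h1, LinearMap.rTensor_sub, LinearMap.sub_apply, h2, sub_zero]

end AdjointCoaction

theorem ext_one_kerEps {k A X : Type*} [Field k] [Ring A] [HopfAlgebra k A] [AddCommGroup X]
    [Module k X] {F G : A →ₗ[k] X} (h1 : F 1 = G 1) (h : ∀ a : kerEps k A, F a = G a) :
    F = G := by
  ext a
  have e : a = (piEps k A a : A) + Coalgebra.counit (R := k) a • (1 : A) := by
    rw [piEps_coe, Algebra.algebraMap_eq_smul_one, sub_add_cancel]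
  rw [e, map_add, map_add, map_smul, map_smul, h1, h]

theorem extendUnit_eq {k A B : Type*} [Field k] [Ring A] [HopfAlgebra k A] [Ring B] [Algebra k B]
    {f : kerEps k A →ₗ[k] Omega k B} {F : A →ₗ[k] B ⊗[k] B} (h1 : F 1 = 1)
    (hF : ∀ a : kerEps k A, F a = f a) : extendUnit f = F :=
  ext_one_kerEps (by rw [extendUnit_one, h1]) fun a => by rw [extendUnit_coe, hF]

/-! ### Connections in terms of their extensions, for a coaction that is an algebra map. -/

section Bundle

variable {k P H : Type*} [Field k] [Ring P] [Algebra k P] [Ring H] [HopfAlgebra k H]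
  (δ : P →ₐ[k] P ⊗[k] H)

/-- `u ↦ (u₍₀₎ ⊗ 1) ⊗ u₍₁₎` -/
def coactInl : P →ₐ[k] (P ⊗[k] P) ⊗[k] H :=
  (Algebra.TensorProduct.map Algebra.TensorProduct.includeLeft (.id k H)).comp δ

/-- `u ↦ (1 ⊗ u₍₀₎) ⊗ u₍₁₎` -/
def coactInr : P →ₐ[k] (P ⊗[k] P) ⊗[k] H :=
  (Algebra.TensorProduct.map Algebra.TensorProduct.includeRight (.id k H)).comp δ

theorem deltaR₂_tmul (u v : P) :
    deltaR₂ δ.toLinearMap (u ⊗ₜ v) = coactInl δ u * coactInr δ v := by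
  simp only [deltaR₂, LinearMap.comp_apply, coactInl, coactInr, AlgHom.comp_apply,
    TensorProduct.map_tmul, AlgHom.toLinearMap_apply]
  induction δ u with
  | zero => simp
  | add x y hx hy => simp only [TensorProduct.add_tmul, map_add, add_mul, hx, hy]
  | tmul x y =>
    induction δ v with
    | zero => simp
    | add x y hx hy => simp only [TensorProduct.tmul_add, map_add, mul_add, hx, hy]
    | tmul z w => simp

theorem deltaR₂_inl_mul_inr (u v : P) (x : P ⊗[k] P) :
    deltaR₂ δ.toLinearMap (inl k P u * (x * inr k P v)) =
      coactInl δ u * (deltaR₂ δ.toLinearMap x * coactInr δ v) := by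
  induction x with
  | zero => simp
  | add x y hx hy => simp only [add_mul, mul_add, map_add, hx, hy]
  | tmul c d => simp [inl_apply, inr_apply, deltaR₂_tmul, mul_assoc]

theorem chi_tmul (u v : P) : chi δ.toLinearMap (u ⊗ₜ v) = (u ⊗ₜ 1) * δ v := by
  simp only [chi, LinearMap.comp_apply, LinearMap.lTensor_tmul, AlgHom.toLinearMap_apply]
  induction δ v with
  | zero => simp
  | add x y hx hy => simp only [TensorProduct.tmul_add, map_add, mul_add, hx, hy]
  | tmul z w => simp

theorem chi_inl_mul_inr (u v : P) (x : P ⊗[k] P) :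
    chi δ.toLinearMap (inl k P u * (x * inr k P v)) =
      (u ⊗ₜ 1) * (chi δ.toLinearMap x * δ v) := by
  induction x with
  | zero => simp
  | add x y hx hy => simp only [add_mul, mul_add, map_add, hx, hy]
  | tmul c d => simp [inl_apply, inr_apply, chi_tmul, ← mul_assoc]

theorem chi_dU (u : P) : chi δ.toLinearMap (dU k P u) = δ u - u ⊗ₜ 1 := by
  simp [dU, inl_apply, inr_apply, chi_tmul, ← Algebra.TensorProduct.one_def]

theorem mul'_inl_mul_inr (u v : P) (x : P ⊗[k] P) :
    LinearMap.mul' k P (inl k P u * (x * inr k P v)) = u * (LinearMap.mul' k P x * v) := by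
  rw [mul'_inl_mul, mul'_mul_inr]

/-- The summand `- u ⊗ 1` of `χ(d_U u)` is killed by `π_ε(1) = 0`. -/
theorem connProj_dU (ω : kerEps k H →ₗ[k] Omega k P) (u : P) :
    connProj δ.toLinearMap ω (dU k P u) = LinearMap.mul' k (P ⊗[k] P)
      (TensorProduct.map (inl k P) ((Omega k P).subtype ∘ₗ ω ∘ₗ piEps k H) (δ u)) := by
  simp [connProj, chi_dU, piEps_one]

/-- Both extended identities hold automatically at `1`, so nothing is added by passing from `ker ε`
to `H`; there they are identities between maps out of a coalgebra and convolution applies. -/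
theorem isConnection_iff (ω : kerEps k H →ₗ[k] Omega k P) :
    IsConnection δ.toLinearMap ω ↔
      chi δ.toLinearMap ∘ₗ extendUnit ω =
        (Algebra.TensorProduct.includeRight : H →ₐ[k] P ⊗[k] H).toLinearMap ∧
      deltaR₂ δ.toLinearMap ∘ₗ extendUnit ω = (extendUnit ω).rTensor H ∘ₗ Ad k H := by
  have e1 : chi δ.toLinearMap 1 = 1 := by
    rw [Algebra.TensorProduct.one_def, chi_tmul, map_one, mul_one]
    rfl
  have e2 : deltaR₂ δ.toLinearMap 1 = 1 := by
    rw [Algebra.TensorProduct.one_def, deltaR₂_tmul, map_one, map_one, one_mul]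
  have e3 : Ad k H 1 = 1 ⊗ₜ 1 := by
    simp [Ad, Algebra.TensorProduct.one_def]
  have e4 : extendUnit ω ∘ₗ (kerEps k H).subtype = (Omega k P).subtype ∘ₗ ω := by
    ext h
    exact extendUnit_coe ω h
  constructor
  · rintro ⟨h1, h2⟩
    constructor
    · refine ext_one_kerEps ?_ fun h => ?_
      · rw [LinearMap.comp_apply, extendUnit_one, e1]
        rfl
      · rw [LinearMap.comp_apply, extendUnit_coe, h1]
        rfl
    · refine ext_one_kerEps ?_ fun h => ?_
      · rw [LinearMap.comp_apply, LinearMap.comp_apply, extendUnit_one, e2, e3,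
          LinearMap.rTensor_tmul, extendUnit_one, ← Algebra.TensorProduct.one_def]
      · rw [LinearMap.comp_apply, LinearMap.comp_apply, extendUnit_coe, h2, ← e4,
          rTensor_AdKer _ (extendUnit_one ω)]
  · rintro ⟨h1, h2⟩
    constructor
    · intro h
      rw [← extendUnit_coe]
      exact LinearMap.congr_fun h1 h
    · intro h
      rw [← extendUnit_coe, ← e4, rTensor_AdKer _ (extendUnit_one ω)]
      exact LinearMap.congr_fun h2 h

end Bundle

namespace Bicross

variable {k M H : Type*} [Field k] [Ring M] [Ring H] [HopfAlgebra k M] [HopfAlgebra k H]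
  (D : MatchedPair k M H)

/-! ### The projections onto `H` and `M` and the right coaction -/

/-- The axiom `ε(h ▷ n) = ε(h) ε(n)` is what makes `π`, and with it `Δ_R`, an algebra map. -/
theorem proj_rel :
    CrossRel D ((Algebra.ofId k H).comp (Bialgebra.counitAlgHom k M)) (.id k H) := by
  intro n
  have h1 : ((Algebra.ofId k H).comp (Bialgebra.counitAlgHom k M)).toLinearMap ∘ₗ
      D.act.toLinearMap.flip n = Coalgebra.counit (R := k) n • convUnit k H H := by
    ext h
    simp [D.counit_act, Algebra.ofId_apply, convUnit_apply, Algebra.smul_def, mul_comm]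
  have h2 : conv (Coalgebra.counit (R := k) n • convUnit k H H) LinearMap.id =
      Coalgebra.counit (R := k) n • conv (convUnit k H H) LinearMap.id := by
    ext h
    simp [conv_apply, TensorProduct.map_smul_left]
  rw [h1, AlgHom.toLinearMap_id, h2, convUnit_conv]
  ext h
  simp [Algebra.ofId_apply, Algebra.smul_def, (Algebra.commutes _ _).symm]

/-- `π` as an algebra map. -/
def projHom : Bicross D →ₐ[k] H :=
  lift D ((Algebra.ofId k H).comp (Bialgebra.counitAlgHom k M)) (.id k H) (proj_rel D)

theorem proj_tm (m : M) (h : H) : proj D (tm D m h) = Coalgebra.counit (R := k) m • h := by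
  simp [proj, tm]

theorem proj_eq : proj D = (projHom D).toLinearMap := by
  apply LinearMap.ext
  intro x
  induction x using induction with
  | zero => simp
  | add x y hx hy => simp only [map_add, hx, hy]
  | tmul m h =>
    rw [proj_tm, AlgHom.toLinearMap_apply, projHom, lift_tm]
    simp [Algebra.ofId_apply, Algebra.smul_def]

theorem projHom_incl (m : M) : projHom D (incl D m) = algebraMap k H (Coalgebra.counit m) :=
  lift_incl ..

theorem projHom_Phi (h : H) : projHom D (Phi D h) = h := lift_Phi ..

/-- `m ⊗ h ↦ m ε(h)` -/
def retr : Bicross D →ₗ[k] M :=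
  (TensorProduct.rid k M).toLinearMap ∘ₗ
    (Coalgebra.counit (R := k) (A := H)).lTensor M ∘ₗ (of D).symm.toLinearMap

theorem retr_tm (m : M) (h : H) : retr D (tm D m h) = Coalgebra.counit (R := k) h • m := by
  simp [retr, tm]

theorem retr_incl (m : M) : retr D (incl D m) = m := by
  rw [incl_apply, retr_tm, Bialgebra.counit_one, one_smul]

theorem retr_incl_mul (m : M) (x : Bicross D) : retr D (incl D m * x) = m * retr D x := by
  induction x using induction with
  | zero => simp
  | add x y hx hy => simp only [mul_add, map_add, hx, hy]
  | tmul n h =>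
    rw [← incl_mul_Phi, ← mul_assoc, ← map_mul, incl_mul_Phi, incl_mul_Phi, retr_tm, retr_tm,
      mul_smul_comm]

theorem retr_Phi (h : H) : retr D (Phi D h) = algebraMap k M (Coalgebra.counit h) := by
  rw [Phi_apply, retr_tm, Algebra.algebraMap_eq_smul_one]

/-- `Δ_R` as an algebra map. -/
def deltaRHom : Bicross D →ₐ[k] Bicross D ⊗[k] H :=
  (Algebra.TensorProduct.map (.id k (Bicross D)) (projHom D)).comp (comulHom D)

theorem deltaR_eq : deltaR D = (deltaRHom D).toLinearMap := by
  rw [deltaR, proj_eq]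
  rfl

theorem deltaRHom_incl (m : M) : deltaRHom D (incl D m) = incl D m ⊗ₜ 1 := by
  have h := congrArg (TensorProduct.map (incl D).toLinearMap (Algebra.linearMap k H))
    (Coalgebra.lTensor_counit_comul (R := k) m)
  rw [deltaRHom, AlgHom.comp_apply, comulHom_incl]
  refine Eq.trans ?_ (h.trans (by simp))
  induction Coalgebra.comul (R := k) m with
  | zero => simp
  | add x y hx hy => simp only [map_add, hx, hy]
  | tmul x y => simp [projHom_incl]

/-- In `Δ(Φ(h)) = Φ(h₁⁽¹⁾) ⊗ h₁⁽²⁾ Φ(h₂)` the projection turns `h₁⁽²⁾` into its counit, and the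
coaction disappears: `Φ` is a comodule map. -/
theorem deltaRHom_comp_Phi : (deltaRHom D).toLinearMap ∘ₗ (Phi D).toLinearMap =
    conv ((Algebra.TensorProduct.includeLeft : _ →ₐ[k] Bicross D ⊗[k] H).toLinearMap ∘ₗ
        (Phi D).toLinearMap)
      (Algebra.TensorProduct.includeRight : _ →ₐ[k] Bicross D ⊗[k] H).toLinearMap := by
  have h1 : (deltaRHom D).toLinearMap ∘ₗ (Phi D).toLinearMap =
      (Algebra.TensorProduct.map (.id k (Bicross D)) (projHom D)).toLinearMap ∘ₗ
        (comulPhi D).toLinearMap := by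
    ext h
    simp [deltaRHom, comulHom_Phi]
  rw [h1, comulPhi_toLinearMap, algHom_comp_conv]
  congr 1
  · ext h
    have h2 := congrArg (fun g => Phi D g ⊗ₜ[k] (1 : H)) (D.coact_counit h)
    refine Eq.trans ?_ h2
    simp only [coactP, LinearMap.comp_apply]
    induction D.coact h with
    | zero => simp
    | add x y hx hy => simp only [map_add, TensorProduct.add_tmul, hx, hy]
    | tmul g n =>
      simp [PhiIncl, projHom_incl, Algebra.algebraMap_eq_smul_one, TensorProduct.smul_tmul]
  · ext h
    simp [oneP, projHom_Phi]

theorem deltaRHom_Phi (h : H) :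
    deltaRHom D (Phi D h) = (Phi D).toLinearMap.rTensor H (Coalgebra.comul h) := by
  refine (LinearMap.congr_fun (deltaRHom_comp_Phi D) h).trans ?_
  rw [conv_apply]
  induction Coalgebra.comul (R := k) h with
  | zero => simp
  | add x y hx hy => simp only [map_add, hx, hy]
  | tmul x y => simp

/-- `u = r(u₍₀₎) Φ(u₍₁₎)` for `r(m ⊗ h) = m ε(h)` -/
theorem retr_deltaRHom (u : Bicross D) : LinearMap.mul' k (Bicross D)
    (TensorProduct.map ((incl D).toLinearMap ∘ₗ retr D) (Phi D).toLinearMap (deltaRHom D u)) =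
      u := by
  induction u using induction with
  | zero => simp
  | add x y hx hy => simp only [map_add, hx, hy]
  | tmul m h =>
    have h1 := congrArg (fun g => incl D m * Phi D (TensorProduct.lid k H g))
      (Coalgebra.rTensor_counit_comul (R := k) h)
    rw [← incl_mul_Phi, map_mul, deltaRHom_incl, deltaRHom_Phi]
    refine Eq.trans ?_ (h1.trans (by simp))
    induction Coalgebra.comul (R := k) h with
    | zero => simp
    | add x y hx hy => simp only [map_add, mul_add, hx, hy]
    | tmul x y =>
      simp [retr_incl_mul, retr_Phi, Algebra.algebraMap_eq_smul_one]

/-! ### The bimodule of one-forms on the base -/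

/-- `M ⊗ M` inside `(M ▶◁ H) ⊗ (M ▶◁ H)`. -/
def inclIncl : M ⊗[k] M →ₐ[k] Bicross D ⊗[k] Bicross D :=
  Algebra.TensorProduct.map (incl D) (incl D)

theorem retr_inclIncl (x : M ⊗[k] M) :
    TensorProduct.map (retr D) (retr D) (inclIncl D x) = x := by
  induction x with
  | zero => simp
  | add x y hx hy => simp only [map_add, hx, hy]
  | tmul a b => simp [inclIncl, retr_incl]

theorem inclIncl_injective : Function.Injective (inclIncl D) :=
  Function.LeftInverse.injective (retr_inclIncl D)

theorem mul'_inclIncl (x : M ⊗[k] M) : LinearMap.mul' k (Bicross D) (inclIncl D x) =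
    incl D (LinearMap.mul' k M x) := by
  induction x with
  | zero => simp
  | add x y hx hy => simp only [map_add, hx, hy]
  | tmul a b => simp [inclIncl]

/-- `h ↦ Φ(h) ⊗ 1` -/
def Pone : H →ₐ[k] Bicross D ⊗[k] Bicross D :=
  (Algebra.TensorProduct.includeLeft).comp (Phi D)

/-- `ω_U + ε = Φ⁻¹ * (β_U + ε) * Φ` -/
theorem extendUnit_connectionOfBeta (β : kerEps k H →ₗ[k] Omega k M) :
    extendUnit (connectionOfBeta D β) = conv ((Pone D).toLinearMap ∘ₗ HopfAlgebra.antipode k)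
      (conv ((inclIncl D).toLinearMap ∘ₗ extendUnit β) (oneP D).toLinearMap) := by
  have h1 : (inclIncl D).toLinearMap ∘ₗ extendUnit β = betaP D β + convUnit k H _ := by
    rw [extendUnit, LinearMap.comp_add, algHom_comp_convUnit]
    rfl
  apply extendUnit_eq
  · rw [conv_one_apply, conv_one_apply]
    simp [extendUnit_one]
  · intro h
    have h2 : Coalgebra.counit (R := k) (h : H) = 0 := h.2
    have h3 : (connectionOfBeta D β h : Bicross D ⊗[k] Bicross D) =
        (conv ((Pone D).toLinearMap ∘ₗ HopfAlgebra.antipode k)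
          (conv (betaP D β) (oneP D).toLinearMap) +
        conv ((Pone D).toLinearMap ∘ₗ HopfAlgebra.antipode k)
          ((oneP D).toLinearMap - (Pone D).toLinearMap)) h := rfl
    rw [h3, h1, add_conv, conv_add, convUnit_conv, conv_sub, antipode_conv, LinearMap.add_apply,
      LinearMap.add_apply, LinearMap.sub_apply, convUnit_apply, h2, map_zero, sub_zero]


/-! ### Equivariance -/

theorem coactInl_comp_Phi : ((coactInl (deltaRHom D)).comp (Phi D)).toLinearMap =
    conv (Algebra.TensorProduct.includeLeft.comp (Pone D) :
        H →ₐ[k] (Bicross D ⊗[k] Bicross D) ⊗[k] H).toLinearMap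
      (Algebra.TensorProduct.includeRight :
        H →ₐ[k] (Bicross D ⊗[k] Bicross D) ⊗[k] H).toLinearMap := by
  have h := congrArg (fun f => (Algebra.TensorProduct.map
    (Algebra.TensorProduct.includeLeft : _ →ₐ[k] Bicross D ⊗[k] Bicross D)
      (.id k H)).toLinearMap ∘ₗ f) (deltaRHom_comp_Phi D)
  simp only [algHom_comp_conv] at h
  refine h.trans (congrArg₂ conv ?_ ?_)
  · ext x
    simp [Pone]
  · ext x
    simp [Algebra.TensorProduct.one_def]

theorem coactInr_comp_Phi : ((coactInr (deltaRHom D)).comp (Phi D)).toLinearMap =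
    conv (Algebra.TensorProduct.includeLeft.comp (oneP D) :
        H →ₐ[k] (Bicross D ⊗[k] Bicross D) ⊗[k] H).toLinearMap
      (Algebra.TensorProduct.includeRight :
        H →ₐ[k] (Bicross D ⊗[k] Bicross D) ⊗[k] H).toLinearMap := by
  have h := congrArg (fun f => (Algebra.TensorProduct.map
    (Algebra.TensorProduct.includeRight : _ →ₐ[k] Bicross D ⊗[k] Bicross D)
      (.id k H)).toLinearMap ∘ₗ f) (deltaRHom_comp_Phi D)
  simp only [algHom_comp_conv] at h
  refine h.trans (congrArg₂ conv ?_ ?_)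
  · ext x
    simp [oneP]
  · ext x
    simp [Algebra.TensorProduct.one_def]

/-- `Φ⁻¹ * B * Φ` is `Ad`-equivariant if and only if `B` is invariant. -/
theorem equivariant_iff (B : H →ₗ[k] Bicross D ⊗[k] Bicross D) :
    deltaR₂ (deltaRHom D).toLinearMap ∘ₗ
        conv ((Pone D).toLinearMap ∘ₗ HopfAlgebra.antipode k) (conv B (oneP D).toLinearMap) =
      (conv ((Pone D).toLinearMap ∘ₗ HopfAlgebra.antipode k)
        (conv B (oneP D).toLinearMap)).rTensor H ∘ₗ Ad k H ↔
    deltaR₂ (deltaRHom D).toLinearMap ∘ₗ B =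
      (Algebra.TensorProduct.includeLeft :
        _ →ₐ[k] (Bicross D ⊗[k] Bicross D) ⊗[k] H).toLinearMap ∘ₗ B := by
  set j : Bicross D ⊗[k] Bicross D →ₐ[k] (Bicross D ⊗[k] Bicross D) ⊗[k] H :=
    Algebra.TensorProduct.includeLeft
  set t : H →ₐ[k] (Bicross D ⊗[k] Bicross D) ⊗[k] H := Algebra.TensorProduct.includeRight
  set S : H →ₗ[k] H := HopfAlgebra.antipode k
  set l := (coactInl (deltaRHom D)).comp (Phi D)
  set r := (coactInr (deltaRHom D)).comp (Phi D)
  -- The inverse of a product: `l` is the convolution product of `Φ ⊗ 1` and `t`, so the factors of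
  -- `l ∘ S` appear in the opposite order.
  have h1 : l.toLinearMap ∘ₗ S =
      conv (t.toLinearMap ∘ₗ S) ((j.comp (Pone D)).toLinearMap ∘ₗ S) := by
    apply conv_right_cancel (conv_antipode l)
    rw [antipode_conv, coactInl_comp_Phi, conv_assoc, ← conv_assoc _ _ t.toLinearMap,
      antipode_conv, convUnit_conv, antipode_conv]
  have h2 : deltaR₂ (deltaRHom D).toLinearMap ∘ₗ
        conv ((Pone D).toLinearMap ∘ₗ S) (conv B (oneP D).toLinearMap) =
      conv (l.toLinearMap ∘ₗ S)
        (conv (deltaR₂ (deltaRHom D).toLinearMap ∘ₗ B) r.toLinearMap) :=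
    comp_conv_conv _ _ _ _ _ _ fun c x d => deltaR₂_inl_mul_inr (deltaRHom D) _ _ x
  -- The factors `S(h₁)` and `h₃` of `Ad` combine with `Φ⁻¹` and `Φ` into the same `l ∘ S` and `r`
  -- as in `h2`, so that only the middle factors have to be compared.
  have h3 : (conv ((Pone D).toLinearMap ∘ₗ S) (conv B (oneP D).toLinearMap)).rTensor H ∘ₗ
      Ad k H = conv (l.toLinearMap ∘ₗ S) (conv (j.toLinearMap ∘ₗ B) r.toLinearMap) := by
    rw [rTensor_comp_Ad, algHom_comp_conv, algHom_comp_conv, h1, coactInr_comp_Phi]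
    simp only [conv_assoc]
    rfl
  rw [h2, h3]
  exact ⟨fun h => conv_right_cancel (conv_antipode r) (conv_left_cancel (conv_antipode l) h),
    fun h => by rw [h]⟩

theorem deltaR₂_inclIncl (x : M ⊗[k] M) :
    deltaR₂ (deltaRHom D).toLinearMap (inclIncl D x) = inclIncl D x ⊗ₜ 1 := by
  induction x with
  | zero => simp
  | add x y hx hy => simp only [map_add, TensorProduct.add_tmul, hx, hy]
  | tmul a b => simp [inclIncl, deltaR₂_tmul, coactInl, coactInr, deltaRHom_incl]

theorem chi_inclIncl (x : M ⊗[k] M) : chi (deltaRHom D).toLinearMap (inclIncl D x) =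
    incl D (LinearMap.mul' k M x) ⊗ₜ 1 := by
  induction x with
  | zero => simp
  | add x y hx hy => simp only [map_add, TensorProduct.add_tmul, hx, hy]
  | tmul a b => simp [inclIncl, chi_tmul, deltaRHom_incl]

/-- No condition on `β` is needed. On `M ⊗ M` the map `χ` is multiplication, which sends `β + ε` to
`ε`, and `Φ⁻¹ * Δ_R Φ = 1 ⊗ id`. Equivariance holds because `M` is coinvariant. -/
theorem isConnection_connectionOfBeta (β : kerEps k H →ₗ[k] Omega k M) :
    IsConnection (deltaR D) (connectionOfBeta D β) := by
  rw [deltaR_eq, isConnection_iff, extendUnit_connectionOfBeta]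
  constructor
  · set i : Bicross D →ₐ[k] Bicross D ⊗[k] H := Algebra.TensorProduct.includeLeft
    have h1 : chi (deltaRHom D).toLinearMap ∘ₗ (inclIncl D).toLinearMap ∘ₗ extendUnit β =
        convUnit k H (Bicross D ⊗[k] H) := by
      ext h
      have := LinearMap.congr_fun (mul'_comp_extendUnit β) h
      rw [LinearMap.comp_apply] at this
      simp [chi_inclIncl, this, convUnit_apply, Algebra.TensorProduct.algebraMap_apply]
    rw [comp_conv_conv (chi (deltaRHom D).toLinearMap)
      ((Pone D).toLinearMap ∘ₗ HopfAlgebra.antipode k) (oneP D).toLinearMap _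
      ((i.comp (Phi D)).toLinearMap ∘ₗ HopfAlgebra.antipode k)
      ((deltaRHom D).toLinearMap ∘ₗ (Phi D).toLinearMap)
      (fun c x d => chi_inl_mul_inr (deltaRHom D) _ _ x), h1, convUnit_conv, deltaRHom_comp_Phi,
      ← conv_assoc]
    exact (congrArg (fun f => conv f _) (antipode_conv (i.comp (Phi D)))).trans (convUnit_conv _)
  · rw [equivariant_iff]
    ext h
    simp [deltaR₂_inclIncl]

/-! ### Strong connections -/

/-- Passing from `ω` to its extension absorbs the summand `- m Φ(h) ⊗ 1` of the differential. -/
theorem dU_sub_connProj (ω : kerEps k H →ₗ[k] Omega k (Bicross D)) (m : M) (h : H) :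
    dU k _ (incl D m * Phi D h) - connProj (deltaR D) ω (dU k _ (incl D m * Phi D h)) =
      inr k _ (incl D m) * oneP D h -
        inl k _ (incl D m) * conv (Pone D).toLinearMap (extendUnit ω) h := by
  have h1 : conv (Pone D).toLinearMap (extendUnit ω) =
      conv (Pone D).toLinearMap ((Omega k (Bicross D)).subtype ∘ₗ ω ∘ₗ piEps k H) +
        (Pone D).toLinearMap := by
    rw [extendUnit, conv_add, conv_convUnit]
  have h2 : connProj (deltaR D) ω (dU k _ (incl D m * Phi D h)) = inl k _ (incl D m) *
      conv (Pone D).toLinearMap ((Omega k (Bicross D)).subtype ∘ₗ ω ∘ₗ piEps k H) h := by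
    rw [deltaR_eq, connProj_dU, map_mul, deltaRHom_incl, deltaRHom_Phi, conv_apply]
    induction Coalgebra.comul (R := k) h with
    | zero => simp
    | add x y hx hy => simp only [map_add, mul_add, hx, hy]
    | tmul x y =>
      simp [inl_apply, Pone, ← mul_assoc]
  rw [h1, h2]
  simp only [dU, LinearMap.sub_apply, LinearMap.add_apply, mul_add, inl_apply, inr_apply, oneP,
    Pone, AlgHom.comp_apply, AlgHom.toLinearMap_apply, Algebra.TensorProduct.includeLeft_apply,
    Algebra.TensorProduct.includeRight_apply, Algebra.TensorProduct.tmul_mul_tmul, mul_one]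
  abel

theorem incl_mem_base (m : M) : incl D m ∈ base (deltaR D) := by
  rw [base, LinearMap.mem_eqLocus, deltaR_eq]
  exact deltaRHom_incl D m

/-- In `u = r(u₍₀₎) Φ(u₍₁₎)` a coinvariant `u` has `u₍₁₎ = 1`; hence the base is `M`. -/
theorem incl_retr_of_mem_base {u : Bicross D} (hu : u ∈ base (deltaR D)) :
    incl D (retr D u) = u := by
  rw [base, LinearMap.mem_eqLocus, deltaR_eq] at hu
  have h := retr_deltaRHom D u
  rw [show deltaRHom D u = u ⊗ₜ 1 from hu] at h
  simpa using h

theorem inclIncl_mem_baseOmega {x : M ⊗[k] M} (hx : LinearMap.mul' k M x = 0) :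
    inclIncl D x ∈ baseOmega (deltaR D) := by
  refine ⟨?_, ?_⟩
  · change LinearMap.mul' k _ (inclIncl D x) = 0
    rw [mul'_inclIncl, hx, map_zero]
  · clear hx
    induction x with
    | zero => simp
    | add x y hx hy => rw [map_add]; exact add_mem hx hy
    | tmul a b =>
      exact ⟨⟨incl D a, incl_mem_base D a⟩ ⊗ₜ ⟨incl D b, incl_mem_base D b⟩, rfl⟩

theorem inclIncl_mul_inr_mem {x : M ⊗[k] M} (hx : LinearMap.mul' k M x = 0) (p : Bicross D) :
    inclIncl D x * inr k _ p ∈ baseOmegaMul (deltaR D) :=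
  Submodule.subset_span ⟨_, inclIncl_mem_baseOmega D hx, p, rfl⟩

/-- Here `Φ * W = β * Φ + 1 ⊗ Φ`, so `(id - Π) d_U(m Φ(h)) = (d_U m) Φ(h) - m β(π_ε(h₁)) Φ(h₂)`, and
both terms visibly lie in `(Ω¹M) P`. -/
theorem isStrong_connectionOfBeta (β : kerEps k H →ₗ[k] Omega k M) :
    IsStrong (deltaR D) (connectionOfBeta D β) := by
  intro u
  induction u using induction with
  | zero => simp
  | add x y hx hy =>
    rw [map_add, map_add, add_sub_add_comm]
    exact add_mem hx hy
  | tmul m h =>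
    have h1 : conv (Pone D).toLinearMap (extendUnit (connectionOfBeta D β)) =
        conv (betaP D β) (oneP D).toLinearMap + (oneP D).toLinearMap := by
      rw [extendUnit_connectionOfBeta, ← conv_assoc, conv_antipode, convUnit_conv, extendUnit,
        LinearMap.comp_add, algHom_comp_convUnit, add_conv, convUnit_conv]
      rfl
    have h2 : inr k _ (incl D m) * oneP D h - inl k _ (incl D m) *
        (conv (betaP D β) (oneP D).toLinearMap + (oneP D).toLinearMap) h =
        inclIncl D (dU k M m) * inr k _ (Phi D h) -
          inl k _ (incl D m) * conv (betaP D β) (oneP D).toLinearMap h := by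
      have e1 : inclIncl D (dU k M m) = inr k _ (incl D m) - inl k _ (incl D m) := by
        simp [dU, inl_apply, inr_apply, inclIncl]
      have e2 : oneP D h = inr k _ (Phi D h) := rfl
      rw [e1, e2, LinearMap.add_apply, mul_add, sub_mul, AlgHom.toLinearMap_apply, e2]
      abel
    rw [← incl_mul_Phi, dU_sub_connProj, h1, h2]
    refine sub_mem (inclIncl_mul_inr_mem D (mul'_dU k M m) _) ?_
    rw [conv_apply]
    induction Coalgebra.comul (R := k) h with
    | zero => simp
    | add x y hx hy =>
      rw [map_add, map_add, mul_add]
      exact add_mem hx hy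
    | tmul x y =>
      have e : inl k _ (incl D m) * (betaP D β x * inr k _ (Phi D y)) =
          inclIncl D (inl k M m * (β (piEps k H x) : M ⊗[k] M)) * inr k _ (Phi D y) := by
        rw [map_mul, ← mul_assoc]
        congr 2
      refine (e ▸ inclIncl_mul_inr_mem D ?_ _ :
        inl k _ (incl D m) * (betaP D β x * inr k _ (Phi D y)) ∈ _)
      rw [mul'_inl_mul, mul'_of_mem_Omega, mul_zero]

/-- `M ⊗ P` inside `P ⊗ P` for `P = M ▶◁ H`. -/
def leftBase : Submodule k (Bicross D ⊗[k] Bicross D) :=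
  LinearMap.eqLocus (((incl D).toLinearMap ∘ₗ retr D).rTensor (Bicross D)) LinearMap.id

theorem mem_leftBase {x : Bicross D ⊗[k] Bicross D} : x ∈ leftBase D ↔
    ((incl D).toLinearMap ∘ₗ retr D).rTensor (Bicross D) x = x := Iff.rfl

theorem mul_inr_mem_leftBase {x : Bicross D ⊗[k] Bicross D} (hx : x ∈ leftBase D)
    (p : Bicross D) : x * inr k _ p ∈ leftBase D := by
  have h : ∀ y, ((incl D).toLinearMap ∘ₗ retr D).rTensor (Bicross D) (y * inr k _ p) =
      ((incl D).toLinearMap ∘ₗ retr D).rTensor (Bicross D) y * inr k _ p := by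
    intro y
    induction y with
    | zero => simp
    | add x y hx hy => simp only [map_add, add_mul, hx, hy]
    | tmul a b => simp [inr_apply]
  rw [mem_leftBase, h, hx]
  rfl

/-- The converse direction uses strength only through this weaker containment; that the resulting
`β` is form-valued comes from `ω` being form-valued. -/
theorem baseOmegaMul_le_leftBase : baseOmegaMul (deltaR D) ≤ leftBase D := by
  refine Submodule.span_le.2 ?_
  rintro _ ⟨x, ⟨-, z, rfl⟩, p, rfl⟩
  apply mul_inr_mem_leftBase
  induction z with
  | zero => simp
  | add x y hx hy => rw [map_add]; exact add_mem hx hy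
  | tmul a b =>
    rw [mem_leftBase]
    simp [TensorProduct.mapIncl, incl_retr_of_mem_base D a.2]

/-- An element of `M ⊗ P` that is invariant under `Δ_R` lies in `M ⊗ M`. -/
theorem inclIncl_of_mem_leftBase {x : Bicross D ⊗[k] Bicross D} (hx : x ∈ leftBase D)
    (h : deltaR₂ (deltaRHom D).toLinearMap x = x ⊗ₜ 1) :
    inclIncl D (TensorProduct.map (retr D) (retr D) x) = x := by
  let f := (incl D).toLinearMap ∘ₗ retr D
  -- `Ψ(u ⊗ v ⊗ h) = u ⊗ f(v) Φ(h)`. On `M ⊗ P` the coaction touches only the second leg and `Ψ`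
  -- undoes it, whereas `Ψ(x ⊗ 1)` applies `f` to that leg. Invariance equates the two, so `f` fixes
  -- the second leg as well.
  let Ψ : (Bicross D ⊗[k] Bicross D) ⊗[k] H →ₗ[k] Bicross D ⊗[k] Bicross D :=
    (LinearMap.mul' k (Bicross D) ∘ₗ TensorProduct.map f (Phi D).toLinearMap).lTensor _ ∘ₗ
      (TensorProduct.assoc k _ _ _).toLinearMap
  have h1 : ∀ y, Ψ (deltaR₂ (deltaRHom D).toLinearMap (f.rTensor _ y)) = f.rTensor _ y := by
    intro y
    induction y with
    | zero => simp
    | add x y hx hy => simp only [map_add, hx, hy]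
    | tmul a b =>
      rw [LinearMap.rTensor_tmul]
      conv_rhs => rw [← retr_deltaRHom D b]
      rw [deltaR₂_tmul]
      simp only [f, coactInl, coactInr, AlgHom.comp_apply, LinearMap.comp_apply,
        AlgHom.toLinearMap_apply, deltaRHom_incl]
      induction deltaRHom D b with
      | zero => simp
      | add x y hx hy => simp only [map_add, mul_add, TensorProduct.tmul_add, hx, hy]
      | tmul u v => simp [Ψ, f]
  have h2 : ∀ y, Ψ (y ⊗ₜ 1) = f.lTensor _ y := by
    intro y
    induction y with
    | zero => simp
    | add x y hx hy => simp only [map_add, TensorProduct.add_tmul, hx, hy]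
    | tmul a b => simp [Ψ]
  have h3 : ∀ y, inclIncl D (TensorProduct.map (retr D) (retr D) y) =
      f.lTensor _ (f.rTensor _ y) := by
    intro y
    induction y with
    | zero => simp
    | add x y hx hy => simp only [map_add, hx, hy]
    | tmul a b => simp [inclIncl, f]
  have h4 : f.rTensor _ x = x := hx
  have h5 := h1 x
  rw [h4, h, h2] at h5
  rw [h3, h4, h5]

/-- Every strong connection comes from a map `β_U`. -/
theorem exists_connectionOfBeta {ω : kerEps k H →ₗ[k] Omega k (Bicross D)}
    (h1 : IsConnection (deltaR D) ω) (h2 : IsStrong (deltaR D) ω) :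
    ∃ β, connectionOfBeta D β = ω := by
  rw [deltaR_eq, isConnection_iff] at h1
  set W := extendUnit ω with hW
  set S : H →ₗ[k] H := HopfAlgebra.antipode k
  -- The only possible candidate, obtained by solving `W = Φ⁻¹ * B * Φ` for `B`.
  set B := conv (Pone D).toLinearMap (conv W ((oneP D).toLinearMap ∘ₗ S)) with hB
  have hWB : W = conv ((Pone D).toLinearMap ∘ₗ S) (conv B (oneP D).toLinearMap) := by
    rw [hB, conv_assoc, conv_assoc, antipode_conv, conv_convUnit, ← conv_assoc, antipode_conv,
      convUnit_conv]
  have hLW : conv (Pone D).toLinearMap W = conv B (oneP D).toLinearMap := by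
    rw [hB, conv_assoc, conv_assoc, antipode_conv, conv_convUnit]
  have hinv : deltaR₂ (deltaRHom D).toLinearMap ∘ₗ B =
      (Algebra.TensorProduct.includeLeft :
        _ →ₐ[k] (Bicross D ⊗[k] Bicross D) ⊗[k] H).toLinearMap ∘ₗ B := by
    rw [← equivariant_iff, ← hWB]
    exact h1.2
  have hone : (1 : Bicross D ⊗[k] Bicross D) ∈ leftBase D := by
    have e : incl D (retr D 1) = 1 := by rw [← map_one (incl D), retr_incl]
    rw [mem_leftBase]
    simp [Algebra.TensorProduct.one_def, e]
  -- Strength at `u = Φ(h)` says that `1 ⊗ Φ(h) - (B * Φ)(h)` lies in `(Ω¹M) P`, hence in `M ⊗ P`.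
  have hmem : ∀ h, conv B (oneP D).toLinearMap h ∈ leftBase D := by
    intro h
    have e := baseOmegaMul_le_leftBase D (h2 (incl D 1 * Phi D h))
    rw [dU_sub_connProj, ← hW, hLW, map_one] at e
    have e1 : (inl k (Bicross D)) 1 = 1 := rfl
    have e2 : (inr k (Bicross D)) 1 = 1 := rfl
    rw [e1, e2, one_mul, one_mul] at e
    have e3 : oneP D h ∈ leftBase D := by
      rw [← one_mul (oneP D h)]
      exact mul_inr_mem_leftBase D hone (Phi D h)
    have := sub_mem e3 e
    rwa [sub_sub_cancel] at this
  -- `M ⊗ P` is stable under right multiplication by `P`, so the factor `Φ` can be removed by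
  -- multiplying with `Φ⁻¹`.
  have hBmem : ∀ h, B h ∈ leftBase D := by
    intro h
    have e : B = conv (conv B (oneP D).toLinearMap) ((oneP D).toLinearMap ∘ₗ S) := by
      rw [conv_assoc, conv_antipode, conv_convUnit]
    rw [e, conv_apply]
    induction Coalgebra.comul (R := k) h with
    | zero => simp
    | add x y hx hy => rw [map_add, map_add]; exact add_mem hx hy
    | tmul x y => exact mul_inr_mem_leftBase D (hmem x) _
  have hBM : (inclIncl D).toLinearMap ∘ₗ TensorProduct.map (retr D) (retr D) ∘ₗ B = B := by
    ext h
    exact inclIncl_of_mem_leftBase D (hBmem h) (LinearMap.congr_fun hinv h)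
  have hB1 : B 1 = 1 := by
    rw [hB, conv_one_apply, conv_one_apply, hW, extendUnit_one]
    simp [S]
  -- `μ ∘ B = Φ * (μ ∘ W) * Φ⁻¹ = Φ * ε * Φ⁻¹ = ε`.
  have hmulB : LinearMap.mul' k (Bicross D) ∘ₗ B = convUnit k H (Bicross D) := by
    rw [hB, comp_conv_conv (LinearMap.mul' k (Bicross D)) _ _ _ (Phi D).toLinearMap
      ((Phi D).toLinearMap ∘ₗ S) (fun c x d => mul'_inl_mul_inr _ _ x), hW,
      mul'_comp_extendUnit, convUnit_conv, conv_antipode]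
  obtain ⟨β, hβ⟩ := exists_extendUnit (F := TensorProduct.map (retr D) (retr D) ∘ₗ B)
    (by
      apply inclIncl_injective D
      rw [map_one (inclIncl D)]
      exact (LinearMap.congr_fun hBM 1).trans hB1)
    (by
      ext h
      apply Function.LeftInverse.injective (retr_incl D)
      rw [LinearMap.comp_apply, ← mul'_inclIncl]
      refine (congrArg _ (LinearMap.congr_fun hBM h)).trans
        ((LinearMap.congr_fun hmulB h).trans ?_)
      simp [convUnit_apply])
  refine ⟨β, extendUnit_injective ?_⟩
  rw [extendUnit_connectionOfBeta, hβ, hBM, ← hWB]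

theorem connectionOfBeta_injective : Function.Injective (connectionOfBeta D) := by
  intro β β' h
  have h1 := congrArg extendUnit h
  rw [extendUnit_connectionOfBeta, extendUnit_connectionOfBeta] at h1
  have h2 := conv_right_cancel (conv_antipode (oneP D))
    (conv_left_cancel (conv_antipode (Pone D)) h1)
  apply extendUnit_injective
  ext a
  exact inclIncl_injective D (LinearMap.congr_fun h2 a)

end Bicross

theorem sub_eq_neg_sub_iff {G : Type*} [AddCommGroup G] (a b x y : G) :
    a - b = -(x - y) ↔ a + x = b + y := by
  rw [neg_sub, sub_eq_sub_iff_add_eq_add, add_comm y]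

/-! ### One-sided linearity on the first leg of a tensor product. -/

section TensorLinear

variable {k M P X Y : Type*} [Field k] [Ring M] [Algebra k M] [Ring P] [Algebra k P] [Ring X]
  [Algebra k X] [Ring Y] [Algebra k Y] (f : P →ₗ[k] M)

theorem rTensor_map_mul (i : M →ₐ[k] P) (hf : ∀ m p, f (i m * p) = m * f p) (J : Y →ₐ[k] X)
    (x : M ⊗[k] Y) (y : P ⊗[k] X) :
    f.rTensor X (Algebra.TensorProduct.map i J x * y) =
      Algebra.TensorProduct.map (.id k M) J x * f.rTensor X y := by
  induction x with
  | zero => simp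
  | add x x' hx hy => simp only [map_add, add_mul, hx, hy]
  | tmul a b =>
    induction y with
    | zero => simp
    | add x y hx hy => simp only [map_add, mul_add, hx, hy]
    | tmul c d => simp [hf]

theorem rTensor_mul_one_tmul (x : P ⊗[k] X) (y : X) :
    f.rTensor X (x * (1 ⊗ₜ y)) = f.rTensor X x * (1 ⊗ₜ y) := by
  induction x with
  | zero => simp
  | add x x' hx hy => simp only [map_add, add_mul, hx, hy]
  | tmul a b => simp

end TensorLinear

namespace Bicross

variable {k M H : Type*} [Field k] [Ring M] [Ring H] [HopfAlgebra k M] [HopfAlgebra k H]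
  (D : MatchedPair k M H)

/-! ### Left-invariance -/

/-- `h ↦ h⁽²⁾ ⊗ h⁽¹⁾` -/
def coactSwap : H →ₗ[k] M ⊗[k] H := (TensorProduct.comm k H M).toLinearMap ∘ₗ D.coact

/-- The summands `ε 1` contribute `1 ⊗ h⁽²⁾` on one side and `h⁽²⁾ ⊗ 1` on the other; their
difference is exactly the `d_U` term of the compatibility condition. -/
theorem betaCompatible_iff (β : kerEps k H →ₗ[k] Omega k M) : BetaCompatible D β ↔
    conv ((Algebra.TensorProduct.includeLeft : M ⊗[k] M →ₐ[k] (M ⊗[k] M) ⊗[k] H).toLinearMap ∘ₗ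
        extendUnit β) ((inr k M).rTensor H ∘ₗ coactSwap D) =
      conv ((inl k M).rTensor H ∘ₗ coactSwap D)
        ((Algebra.TensorProduct.includeLeft :
          M ⊗[k] M →ₐ[k] (M ⊗[k] M) ⊗[k] H).toLinearMap ∘ₗ extendUnit β) := by
  rw [extendUnit, LinearMap.comp_add, algHom_comp_convUnit, add_conv, conv_add, convUnit_conv,
    conv_convUnit]
  have h' : (dU k M).rTensor H ∘ₗ coactSwap D =
      (inr k M).rTensor H ∘ₗ coactSwap D - (inl k M).rTensor H ∘ₗ coactSwap D := by
    rw [dU, LinearMap.rTensor_sub, LinearMap.sub_comp]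
  refine Iff.trans ?_ (sub_eq_neg_sub_iff (G := H →ₗ[k] (M ⊗[k] M) ⊗[k] H) _ _ _ _)
  rw [← h']
  rfl

/-- `m ⊗ (u ⊗ v) ↦ m ⊗ (u ⊗ v)`, from `M ⊗ (M ⊗ M)` to `P ⊗ (P ⊗ P)` for `P = M ▶◁ H`. -/
def inclThree : M ⊗[k] (M ⊗[k] M) →ₐ[k] Bicross D ⊗[k] (Bicross D ⊗[k] Bicross D) :=
  Algebra.TensorProduct.map (incl D) (inclIncl D)

/-- `M` is a subbialgebra of `M ▶◁ H`, so the left coaction of the large algebra restricts to that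
of `M`. -/
theorem deltaL_inclIncl (x : M ⊗[k] M) :
    deltaL k (Bicross D) (inclIncl D x) = inclThree D (deltaL k M x) := by
  have hl : ∀ m, comulInl k (Bicross D) (incl D m) = inclThree D (comulInl k M m) := by
    intro m
    simp only [comulInl, AlgHom.comp_apply, Bialgebra.comulAlgHom_apply]
    rw [comul_def, AlgHom.toLinearMap_apply, comulHom_incl]
    induction Coalgebra.comul (R := k) m with
    | zero => simp
    | add x y hx hy => simp only [map_add, hx, hy]
    | tmul a b => simp [inclThree, inclIncl]
  have hr : ∀ m, comulInr k (Bicross D) (incl D m) = inclThree D (comulInr k M m) := by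
    intro m
    simp only [comulInr, AlgHom.comp_apply, Bialgebra.comulAlgHom_apply]
    rw [comul_def, AlgHom.toLinearMap_apply, comulHom_incl]
    induction Coalgebra.comul (R := k) m with
    | zero => simp
    | add x y hx hy => simp only [map_add, hx, hy]
    | tmul a b => simp [inclThree, inclIncl]
  induction x with
  | zero => simp
  | add x y hx hy => simp only [map_add, hx, hy]
  | tmul a b =>
    have : inclIncl D (a ⊗ₜ b) = incl D a ⊗ₜ incl D b := rfl
    rw [this, deltaL_tmul, deltaL_tmul, hl, hr, map_mul]

/-- `h ↦ Φ(h⁽¹⁾) ⊗ (h⁽²⁾ ⊗ 1)` -/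
def coactInlP : H →ₗ[k] Bicross D ⊗[k] (Bicross D ⊗[k] Bicross D) :=
  (inl k (Bicross D)).lTensor _ ∘ₗ coactP D

/-- `h ↦ Φ(h⁽¹⁾) ⊗ (1 ⊗ h⁽²⁾)` -/
def coactInrP : H →ₗ[k] Bicross D ⊗[k] (Bicross D ⊗[k] Bicross D) :=
  (inr k (Bicross D)).lTensor _ ∘ₗ coactP D

theorem comulInl_comp_Phi : ((comulInl k (Bicross D)).comp (Phi D)).toLinearMap =
    conv (coactInlP D) ((oneTmul k (Bicross D)).comp (Pone D)).toLinearMap := by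
  have h1 : ((comulInl k (Bicross D)).comp (Phi D)).toLinearMap =
      (Algebra.TensorProduct.map (.id k (Bicross D)) (Algebra.TensorProduct.includeLeft :
        _ →ₐ[k] Bicross D ⊗[k] Bicross D)).toLinearMap ∘ₗ (comulPhi D).toLinearMap := by
    ext h
    exact congrArg _ (comulHom_Phi D h)
  rw [h1, comulPhi_toLinearMap, algHom_comp_conv]
  congr 1

theorem comulInr_comp_Phi : ((comulInr k (Bicross D)).comp (Phi D)).toLinearMap =
    conv (coactInrP D) ((oneTmul k (Bicross D)).comp (oneP D)).toLinearMap := by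
  have h1 : ((comulInr k (Bicross D)).comp (Phi D)).toLinearMap =
      (Algebra.TensorProduct.map (.id k (Bicross D)) (Algebra.TensorProduct.includeRight :
        _ →ₐ[k] Bicross D ⊗[k] Bicross D)).toLinearMap ∘ₗ (comulPhi D).toLinearMap := by
    ext h
    exact congrArg _ (comulHom_Phi D h)
  rw [h1, comulPhi_toLinearMap, algHom_comp_conv]
  congr 1

/-- `Φ⁻¹ * B * Φ` is left-invariant if and only if
`Δ_L(B(h₁)) (Φ(h₂⁽¹⁾) ⊗ 1 ⊗ h₂⁽²⁾) = Φ(h₁⁽¹⁾) ⊗ h₁⁽²⁾ B(h₂)`. -/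
theorem leftInvariant_conv_iff (B : H →ₗ[k] Bicross D ⊗[k] Bicross D) :
    deltaL k (Bicross D) ∘ₗ
        conv ((Pone D).toLinearMap ∘ₗ HopfAlgebra.antipode k) (conv B (oneP D).toLinearMap) =
      (oneTmul k (Bicross D)).toLinearMap ∘ₗ
        conv ((Pone D).toLinearMap ∘ₗ HopfAlgebra.antipode k) (conv B (oneP D).toLinearMap) ↔
    conv (deltaL k (Bicross D) ∘ₗ B) (coactInrP D) =
      conv (coactInlP D) ((oneTmul k (Bicross D)).toLinearMap ∘ₗ B) := by
  set S : H →ₗ[k] H := HopfAlgebra.antipode k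
  set ι := oneTmul k (Bicross D)
  set l := (comulInl k (Bicross D)).comp (Phi D)
  set r := (comulInr k (Bicross D)).comp (Phi D)
  have h1 : deltaL k (Bicross D) ∘ₗ
        conv ((Pone D).toLinearMap ∘ₗ S) (conv B (oneP D).toLinearMap) =
      conv (l.toLinearMap ∘ₗ S) (conv (deltaL k (Bicross D) ∘ₗ B) r.toLinearMap) :=
    comp_conv_conv _ _ _ _ _ _ fun c x d => deltaL_inl_mul_inr _ _ x
  -- Checked after multiplying by `l` on the left. Since `l = coactInlP * (ι ∘ Pone)`, the second
  -- factor cancels `ι ∘ Φ⁻¹` and leaves `coactInlP`. No inverse of `coactInlP` is needed.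
  have h2 : ι.toLinearMap ∘ₗ conv ((Pone D).toLinearMap ∘ₗ S) (conv B (oneP D).toLinearMap) =
      conv (l.toLinearMap ∘ₗ S) (conv (conv (coactInlP D) (ι.toLinearMap ∘ₗ B))
        (ι.comp (oneP D)).toLinearMap) := by
    apply conv_left_cancel (antipode_conv l)
    rw [← conv_assoc (l.toLinearMap), conv_antipode, convUnit_conv, algHom_comp_conv,
      algHom_comp_conv, comulInl_comp_Phi]
    have e := conv_antipode (ι.comp (Pone D))
    simp only [conv_assoc]
    rw [← conv_assoc (ι.comp (Pone D)).toLinearMap]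
    exact congrArg (conv _) ((congrArg (fun f => conv f _) e).trans (convUnit_conv _))
  rw [h1, h2, comulInr_comp_Phi, ← conv_assoc (deltaL k (Bicross D) ∘ₗ B)]
  exact ⟨fun h => conv_right_cancel (conv_antipode (ι.comp (oneP D)))
    (conv_left_cancel (conv_antipode l) h), fun h => by rw [h]⟩

/-- `x ⊗ h ↦ Φ(h) ⊗ x` -/
def swapIncl : (M ⊗[k] M) ⊗[k] H →ₐ[k] Bicross D ⊗[k] (Bicross D ⊗[k] Bicross D) :=
  (Algebra.TensorProduct.map (Phi D) (inclIncl D)).comp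
    (Algebra.TensorProduct.comm k (M ⊗[k] M) H).toAlgHom

theorem swapIncl_tmul (x : M ⊗[k] M) (h : H) :
    swapIncl D (x ⊗ₜ h) = Phi D h ⊗ₜ inclIncl D x := rfl

theorem swapIncl_injective : Function.Injective (swapIncl D) := by
  refine Function.LeftInverse.injective (g := (TensorProduct.comm k H (M ⊗[k] M)) ∘
    TensorProduct.map (proj D) (TensorProduct.map (retr D) (retr D))) fun x => ?_
  simp only [Function.comp_apply]
  induction x with
  | zero => simp
  | add x y hx hy => simp only [map_add, hx, hy]
  | tmul x h => simp [swapIncl_tmul, retr_inclIncl, proj_eq, projHom_Phi]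

theorem swapIncl_coactSwap_inr :
    (swapIncl D).toLinearMap ∘ₗ (inr k M).rTensor H ∘ₗ coactSwap D = coactInrP D := by
  ext h
  simp only [LinearMap.comp_apply, coactSwap, coactInrP, coactP]
  induction D.coact h with
  | zero => simp
  | add x y hx hy => simp only [map_add, hx, hy]
  | tmul g n => simp [swapIncl_tmul, inclIncl, PhiIncl, inr_apply]

theorem swapIncl_coactSwap_inl :
    (swapIncl D).toLinearMap ∘ₗ (inl k M).rTensor H ∘ₗ coactSwap D = coactInlP D := by
  ext h
  simp only [LinearMap.comp_apply, coactSwap, coactInlP, coactP]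
  induction D.coact h with
  | zero => simp
  | add x y hx hy => simp only [map_add, hx, hy]
  | tmul g n => simp [swapIncl_tmul, inclIncl, PhiIncl, inl_apply]

/-- The retraction sends `Φ(h⁽¹⁾)` to `ε(h⁽¹⁾)`, and `ε(h⁽¹⁾) h⁽²⁾ = ε(h)`. Thus projecting the
first leg to `M` erases the coaction. -/
theorem rTensor_retr_coactInrP :
    (retr D).rTensor _ ∘ₗ coactInrP D = convUnit k H (M ⊗[k] (Bicross D ⊗[k] Bicross D)) := by
  ext h
  have e := congrArg (fun m => (1 : M) ⊗ₜ[k] inr k _ (incl D m)) (D.counit_coact h)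
  simp only [LinearMap.comp_apply, coactInrP, coactP]
  refine Eq.trans ?_ (e.trans ?_)
  · induction D.coact h with
    | zero => simp
    | add x y hx hy => simp only [map_add, TensorProduct.tmul_add, hx, hy]
    | tmul g n =>
      simp [PhiIncl, retr_Phi, Algebra.algebraMap_eq_smul_one, TensorProduct.smul_tmul]
  · simp [convUnit_apply, Algebra.algebraMap_eq_smul_one, inr_apply,
      Algebra.TensorProduct.one_def]

theorem rTensor_retr_coactInlP :
    (retr D).rTensor _ ∘ₗ coactInlP D = convUnit k H (M ⊗[k] (Bicross D ⊗[k] Bicross D)) := by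
  ext h
  have e := congrArg (fun m => (1 : M) ⊗ₜ[k] inl k _ (incl D m)) (D.counit_coact h)
  simp only [LinearMap.comp_apply, coactInlP, coactP]
  refine Eq.trans ?_ (e.trans ?_)
  · induction D.coact h with
    | zero => simp
    | add x y hx hy => simp only [map_add, TensorProduct.tmul_add, hx, hy]
    | tmul g n =>
      simp [PhiIncl, retr_Phi, Algebra.algebraMap_eq_smul_one, TensorProduct.smul_tmul]
  · simp [convUnit_apply, Algebra.algebraMap_eq_smul_one, inl_apply,
      Algebra.TensorProduct.one_def]

/-- One identity for `B` encodes two conditions. Projecting its first leg to `M` erases the coaction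
terms and leaves `Δ_L B = 1 ⊗ B`. Once this is known, both sides lie in the image of the injective
algebra map `swapIncl`, and pulling back gives the compatibility condition. -/
theorem isLeftInvariant_connectionOfBeta_iff (β : kerEps k H →ₗ[k] Omega k M) :
    IsLeftInvariant (connectionOfBeta D β) ↔ IsLeftInvariant β ∧ BetaCompatible D β := by
  rw [isLeftInvariant_iff, extendUnit_connectionOfBeta, leftInvariant_conv_iff,
    isLeftInvariant_iff, betaCompatible_iff]
  set B := extendUnit β
  have h1 : deltaL k (Bicross D) ∘ₗ (inclIncl D).toLinearMap ∘ₗ B =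
      (inclThree D).toLinearMap ∘ₗ deltaL k M ∘ₗ B := by
    ext h
    exact deltaL_inclIncl D (B h)
  set b := (Algebra.TensorProduct.includeLeft :
    M ⊗[k] M →ₐ[k] (M ⊗[k] M) ⊗[k] H).toLinearMap ∘ₗ B
  have h2 : (oneTmul k (Bicross D)).toLinearMap ∘ₗ (inclIncl D).toLinearMap ∘ₗ B =
      (swapIncl D).toLinearMap ∘ₗ b := by
    ext h
    simp [b, swapIncl_tmul, oneTmul_apply]
  have h3 : (inclThree D).toLinearMap ∘ₗ (oneTmul k M).toLinearMap ∘ₗ B =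
      (swapIncl D).toLinearMap ∘ₗ b := by
    ext h
    simp [b, swapIncl_tmul, oneTmul_apply, inclThree]
  have h4 : deltaL k M ∘ₗ B = (oneTmul k M).toLinearMap ∘ₗ B →
      (conv (deltaL k (Bicross D) ∘ₗ (inclIncl D).toLinearMap ∘ₗ B) (coactInrP D) =
        conv (coactInlP D)
          ((oneTmul k (Bicross D)).toLinearMap ∘ₗ (inclIncl D).toLinearMap ∘ₗ B) ↔
      conv b ((inr k M).rTensor H ∘ₗ coactSwap D) =
        conv ((inl k M).rTensor H ∘ₗ coactSwap D) b) := by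
    intro h
    rw [h1, h, h3, h2, ← swapIncl_coactSwap_inr, ← swapIncl_coactSwap_inl, ← algHom_comp_conv,
      ← algHom_comp_conv]
    constructor
    · intro e
      ext x
      exact swapIncl_injective D (LinearMap.congr_fun e x)
    · intro e
      rw [e]
  constructor
  · intro h
    suffices h5 : deltaL k M ∘ₗ B = (oneTmul k M).toLinearMap ∘ₗ B from ⟨h5, (h4 h5).1 h⟩
    -- The first leg of `Δ_L B` lies in `M`, so left `M`-linearity of the retraction suffices; in
    -- `e2` below, the first leg of `1 ⊗ B` is `1`.
    have e1 : (retr D).rTensor _ ∘ₗ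
        conv ((inclThree D).toLinearMap ∘ₗ deltaL k M ∘ₗ B) (coactInrP D) =
        (Algebra.TensorProduct.map (.id k M) (inclIncl D)).toLinearMap ∘ₗ deltaL k M ∘ₗ B := by
      have e := comp_conv_of_left ((retr D).rTensor (Bicross D ⊗[k] Bicross D))
        ((inclThree D).toLinearMap ∘ₗ deltaL k M ∘ₗ B) (coactInrP D)
        ((Algebra.TensorProduct.map (.id k M) (inclIncl D)).toLinearMap ∘ₗ deltaL k M ∘ₗ B)
        (fun c d => rTensor_map_mul _ _ (retr_incl_mul D) _ _ _)
      exact e.trans ((congrArg _ (rTensor_retr_coactInrP D)).trans (conv_convUnit _))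
    have e2 : (retr D).rTensor _ ∘ₗ conv (coactInlP D)
        ((oneTmul k (Bicross D)).toLinearMap ∘ₗ (inclIncl D).toLinearMap ∘ₗ B) =
        (Algebra.TensorProduct.map (.id k M) (inclIncl D)).toLinearMap ∘ₗ
          (oneTmul k M).toLinearMap ∘ₗ B := by
      have e := comp_conv_of_right ((retr D).rTensor (Bicross D ⊗[k] Bicross D)) (coactInlP D)
        ((oneTmul k (Bicross D)).toLinearMap ∘ₗ (inclIncl D).toLinearMap ∘ₗ B)
        ((Algebra.TensorProduct.map (.id k M) (inclIncl D)).toLinearMap ∘ₗ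
          (oneTmul k M).toLinearMap ∘ₗ B)
        (fun c d => rTensor_mul_one_tmul _ _ _)
      exact e.trans ((congrArg (fun f => conv f _) (rTensor_retr_coactInlP D)).trans
        (convUnit_conv _))
    rw [h1] at h
    rw [h, e2] at e1
    have inj : Function.Injective (Algebra.TensorProduct.map (.id k M) (inclIncl D)) := by
      refine Function.LeftInverse.injective
        (g := (TensorProduct.map (retr D) (retr D)).lTensor M) fun x => ?_
      induction x with
      | zero => simp
      | add x y hx hy => simp only [map_add, hx, hy]
      | tmul a b => simp [retr_inclIncl]
    ext x
    exact (inj (LinearMap.congr_fun e1 x)).symm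
  · rintro ⟨h5, h6⟩
    exact (h4 h5).2 h6

theorem bijOn_connectionOfBeta :
    Set.BijOn (connectionOfBeta D) (admissibleBetas D) (strongInvariantConnections D) := by
  refine ⟨fun β hβ => ⟨isConnection_connectionOfBeta D β, isStrong_connectionOfBeta D β,
    (isLeftInvariant_connectionOfBeta_iff D β).2 hβ⟩, (connectionOfBeta_injective D).injOn, ?_⟩
  rintro ω ⟨h1, h2, h3⟩
  obtain ⟨β, rfl⟩ := exists_connectionOfBeta D h1 h2
  exact ⟨β, (isLeftInvariant_connectionOfBeta_iff D β).1 h3, rfl⟩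

end Bicross

/-! ### Further identities for `S(a₁) ⊗ a₂`. -/

section LeftInv

variable {k A : Type*} [Field k] [Ring A] [HopfAlgebra k A]

theorem leftInv_one : leftInv k A 1 = 1 := by
  simp [leftInv, Algebra.TensorProduct.one_def]

theorem counitLeft_mul_inr (x : A ⊗[k] A) (b : A) :
    counitLeft k A (x * inr k A b) = counitLeft k A x * b := by
  induction x with
  | zero => simp
  | add x y hx hy => simp only [map_add, add_mul, hx, hy]
  | tmul c d => simp [inr_apply, counitLeft_tmul]

theorem counitLeft_inl_mul (a : A) (x : A ⊗[k] A) :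
    counitLeft k A (inl k A a * x) = Coalgebra.counit (R := k) a • counitLeft k A x := by
  induction x with
  | zero => simp
  | add x y hx hy => simp only [map_add, mul_add, smul_add, hx, hy]
  | tmul c d => simp [inl_apply, counitLeft_tmul, mul_smul]

/-- Multiplying out `S(a₁) a₂ = ε(a)` turns the fact that one-forms lie in `ker μ` into counit
preservation, both for `γ` and for the splitting. -/
theorem counit_of_mul'_leftInv {H : Type*} [Ring H] [HopfAlgebra k H] {f : H →ₗ[k] A}
    (hf : LinearMap.mul' k A ∘ₗ leftInv k A ∘ₗ f = convUnit k H A) (h : H) :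
    Coalgebra.counit (R := k) (f h) = Coalgebra.counit (R := k) h := by
  have := congrArg (Coalgebra.counit (R := k)) (LinearMap.congr_fun hf h)
  rw [LinearMap.comp_apply, LinearMap.comp_apply, mul'_leftInv, convUnit_apply] at this
  simpa using this

/-- `S((a b)₁) ⊗ (a b)₂ = S(b₁) S(a₁) ⊗ a₂ b₂` -/
theorem leftInv_comp_mulLeft (a : A) : leftInv k A ∘ₗ LinearMap.mulLeft k a =
    conv (inl k A ∘ₗ HopfAlgebra.antipode k)
      (LinearMap.mulLeft k (leftInv k A a) ∘ₗ inr k A) := by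
  ext b
  simp only [LinearMap.comp_apply, LinearMap.mulLeft_apply, leftInv, conv_apply,
    Bialgebra.comul_mul]
  induction Coalgebra.comul (R := k) b with
  | zero => simp
  | add x y hx hy => simp only [map_add, mul_add, hx, hy]
  | tmul x y =>
    simp only [TensorProduct.map_tmul, LinearMap.mul'_apply, LinearMap.comp_apply,
      LinearMap.mulLeft_apply]
    induction Coalgebra.comul (R := k) a with
    | zero => simp
    | add x y hx hy => simp only [map_add, add_mul, mul_add, hx, hy]
    | tmul z w =>
      simp [inl_apply, inr_apply, HopfAlgebra.antipode_mul_antidistrib]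

/-- `b₁ S((a b₂)₁) ⊗ (a b₂)₂ = S(a₁) ⊗ a₂ b` -/
theorem conv_inl_leftInv_comp_mulLeft (a : A) :
    conv (inl k A) (leftInv k A ∘ₗ LinearMap.mulLeft k a) =
      LinearMap.mulLeft k (leftInv k A a) ∘ₗ inr k A := by
  have h := conv_antipode (Algebra.TensorProduct.includeLeft : A →ₐ[k] A ⊗[k] A)
  rw [leftInv_comp_mulLeft, ← conv_assoc]
  exact (congrArg (fun f => conv f _) h).trans (convUnit_conv _)

end LeftInv

namespace Bicross

variable {k M H : Type*} [Field k] [Ring M] [Ring H] [HopfAlgebra k M] [HopfAlgebra k H]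
  (D : MatchedPair k M H)

/-! ### The maps `γ` -/

theorem extendUnit_betaOfGamma {γ : H →ₗ[k] M} (h1 : γ 1 = 1)
    (h2 : ∀ h, Coalgebra.counit (R := k) (γ h) = Coalgebra.counit (R := k) h) :
    extendUnit (betaOfGamma γ) = leftInv k M ∘ₗ γ := by
  apply extendUnit_eq
  · rw [LinearMap.comp_apply, h1, leftInv_one]
  · intro h
    have h3 : Coalgebra.counit (R := k) (h : H) = 0 := h.2
    have e : (betaOfGamma γ h : M ⊗[k] M) = maurerCartan k M (γ h) := rfl
    rw [e, maurerCartan_coe, h2, h3, map_zero, sub_zero, LinearMap.comp_apply]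

/-- `m ⊗ g ↦ g⁽²⁾ S(m₁) ⊗ m₂ ⊗ g⁽¹⁾` -/
def coactLeftInv : M ⊗[k] H →ₗ[k] (M ⊗[k] M) ⊗[k] H :=
  LinearMap.mul' k _ ∘ₗ TensorProduct.map ((inl k M).rTensor H ∘ₗ coactSwap D)
    ((Algebra.TensorProduct.includeLeft : M ⊗[k] M →ₐ[k] (M ⊗[k] M) ⊗[k] H).toLinearMap ∘ₗ
      leftInv k M) ∘ₗ (TensorProduct.comm k M H).toLinearMap

theorem coactLeftInv_tmul (m : M) (g : H) : coactLeftInv D (m ⊗ₜ g) =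
    (inl k M).rTensor H (coactSwap D g) * (leftInv k M m ⊗ₜ 1) := by
  simp [coactLeftInv]

/-- This is coassociativity of the coaction under `Ξ : g ⊗ (u ⊗ v) ↦ u S((m v)₁) ⊗ (m v)₂ ⊗ g`.
After moving the second coaction into `M`, the factor `u` cancels against the antipode by
`conv_inl_leftInv_comp_mulLeft`. -/
theorem coactLeftInv_mul_coactSwap (m : M) (g : H) :
    coactLeftInv D ((m ⊗ₜ 1) * coactSwap D g) =
      (leftInv k M m ⊗ₜ 1) * (inr k M).rTensor H (coactSwap D g) := by
  let Ξ : H ⊗[k] (M ⊗[k] M) →ₗ[k] (M ⊗[k] M) ⊗[k] H :=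
    (TensorProduct.comm k _ _).toLinearMap ∘ₗ (LinearMap.mul' k (M ⊗[k] M) ∘ₗ
      TensorProduct.map (inl k M) (leftInv k M ∘ₗ LinearMap.mulLeft k m)).lTensor H
  have h := congrArg Ξ (D.coact_coassoc g)
  refine Eq.trans ?_ (h.trans ?_)
  · simp only [coactSwap, LinearMap.comp_apply]
    induction D.coact g with
    | zero => simp
    | add x y hx hy => simp only [map_add, mul_add, hx, hy]
    | tmul a n =>
      simp only [LinearEquiv.coe_coe, TensorProduct.comm_tmul,
        Algebra.TensorProduct.tmul_mul_tmul, one_mul, coactLeftInv_tmul, coactSwap,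
        LinearMap.comp_apply, LinearMap.rTensor_tmul]
      induction D.coact a with
      | zero => simp
      | add x y hx hy => simp only [map_add, add_mul, TensorProduct.add_tmul, hx, hy]
      | tmul b p => simp [Ξ]
  · simp only [coactSwap, LinearMap.comp_apply]
    induction D.coact g with
    | zero => simp
    | add x y hx hy => simp only [map_add, mul_add, hx, hy]
    | tmul a n =>
      have e := LinearMap.congr_fun (conv_inl_leftInv_comp_mulLeft (k := k) m) n
      rw [conv_apply] at e
      simp [Ξ, e]

/-- The two equations are images of each other: `coactLeftInv` carries the one for `γ` to the one
for `S(γ₁) ⊗ γ₂`, and `ε ⊗ id` on the two legs in `M` carries it back, with `h⁽¹⁾ ε(h⁽²⁾) = h`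
simplifying the right-hand side. -/
theorem gammaCompatible_iff (γ : H →ₗ[k] M) : GammaCompatible D γ ↔
    conv ((Algebra.TensorProduct.includeLeft : M ⊗[k] M →ₐ[k] (M ⊗[k] M) ⊗[k] H).toLinearMap ∘ₗ
        leftInv k M ∘ₗ γ) ((inr k M).rTensor H ∘ₗ coactSwap D) =
      conv ((inl k M).rTensor H ∘ₗ coactSwap D)
        ((Algebra.TensorProduct.includeLeft :
          M ⊗[k] M →ₐ[k] (M ⊗[k] M) ⊗[k] H).toLinearMap ∘ₗ leftInv k M ∘ₗ γ) := by
  have h0 : GammaCompatible D γ ↔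
      conv ((Algebra.TensorProduct.includeLeft : M →ₐ[k] M ⊗[k] H).toLinearMap ∘ₗ γ)
        (coactSwap D) = γ.rTensor H ∘ₗ (TensorProduct.comm k H H).toLinearMap ∘ₗ
          Coalgebra.comul := Iff.rfl
  rw [h0]
  constructor
  · intro h
    have e1 : coactLeftInv D ∘ₗ conv ((Algebra.TensorProduct.includeLeft :
        M →ₐ[k] M ⊗[k] H).toLinearMap ∘ₗ γ) (coactSwap D) =
        conv ((Algebra.TensorProduct.includeLeft :
            M ⊗[k] M →ₐ[k] (M ⊗[k] M) ⊗[k] H).toLinearMap ∘ₗ leftInv k M ∘ₗ γ)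
          ((inr k M).rTensor H ∘ₗ coactSwap D) := by
      ext x
      simp only [LinearMap.comp_apply, conv_apply]
      induction Coalgebra.comul (R := k) x with
      | zero => simp
      | add x y hx hy => simp only [map_add, hx, hy]
      | tmul a b =>
        simpa using coactLeftInv_mul_coactSwap D (γ a) b
    rw [← e1, h]
    ext x
    simp only [LinearMap.comp_apply, conv_apply]
    induction Coalgebra.comul (R := k) x with
    | zero => simp
    | add x y hx hy => simp only [map_add, hx, hy]
    | tmul a b => simp [coactLeftInv_tmul]
  · intro h
    have e1 : ∀ (x : M ⊗[k] M) (t : M ⊗[k] H), (counitLeft k M).rTensor H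
        ((x ⊗ₜ 1) * (inr k M).rTensor H t) = (counitLeft k M x ⊗ₜ 1) * t := by
      intro x t
      induction t with
      | zero => simp
      | add x y hx hy => simp only [map_add, mul_add, hx, hy]
      | tmul a b => simp [counitLeft_mul_inr]
    have e2 : ∀ (x : M ⊗[k] M) (g : H), (counitLeft k M).rTensor H
        ((inl k M).rTensor H (coactSwap D g) * (x ⊗ₜ 1)) = counitLeft k M x ⊗ₜ g := by
      intro x g
      have e3 := congrArg (fun a => counitLeft k M x ⊗ₜ[k] a) (D.coact_counit g)
      refine Eq.trans ?_ e3
      simp only [coactSwap, LinearMap.comp_apply]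
      induction D.coact g with
      | zero => simp
      | add x y hx hy => simp only [map_add, add_mul, TensorProduct.tmul_add, hx, hy]
      | tmul a n => simp [counitLeft_inl_mul, TensorProduct.smul_tmul']
    have e4 := congrArg (fun f => (counitLeft k M).rTensor H ∘ₗ f) h
    ext x
    have e5 := LinearMap.congr_fun e4 x
    simp only [LinearMap.comp_apply, conv_apply] at e5 ⊢
    refine Eq.trans ?_ (e5.trans ?_)
    · induction Coalgebra.comul (R := k) x with
      | zero => simp
      | add x y hx hy => simp only [map_add, hx, hy]
      | tmul a b => simp [e1, counitLeft_leftInv]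
    · induction Coalgebra.comul (R := k) x with
      | zero => simp
      | add x y hx hy => simp only [map_add, hx, hy]
      | tmul a b => simp [e2, counitLeft_leftInv]

theorem betaOfGamma_mem {γ : H →ₗ[k] M} (hγ : γ ∈ admissibleGammas D) :
    betaOfGamma γ ∈ admissibleBetas D := by
  obtain ⟨h1, h2, h3⟩ := hγ
  refine ⟨?_, ?_⟩
  · rw [isLeftInvariant_iff, extendUnit_betaOfGamma h1 h2]
    ext h
    exact deltaL_leftInv (γ h)
  · rw [betaCompatible_iff, extendUnit_betaOfGamma h1 h2, ← gammaCompatible_iff]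
    exact h3

theorem bijOn_betaOfGamma :
    Set.BijOn betaOfGamma (admissibleGammas D) (admissibleBetas D) := by
  refine ⟨fun γ hγ => betaOfGamma_mem D hγ, ?_, ?_⟩
  · rintro γ ⟨h1, h2, -⟩ γ' ⟨h1', h2', -⟩ h
    have e := congrArg extendUnit h
    rw [extendUnit_betaOfGamma h1 h2, extendUnit_betaOfGamma h1' h2'] at e
    ext x
    rw [← counitLeft_leftInv (k := k) (γ x), ← counitLeft_leftInv (k := k) (γ' x)]
    exact congrArg _ (LinearMap.congr_fun e x)
  · rintro β ⟨h1, h2⟩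
    rw [isLeftInvariant_iff] at h1
    -- The preimage is `γ = (ε ⊗ id) ∘ (β + ε)`; this identity turns each requirement on `γ` into a
    -- known property of `β`.
    have e : leftInv k M ∘ₗ counitLeft k M ∘ₗ extendUnit β = extendUnit β := by
      ext h
      exact leftInv_counitLeft (LinearMap.congr_fun h1 h)
    have h3 : (counitLeft k M ∘ₗ extendUnit β) 1 = 1 := by
      rw [LinearMap.comp_apply, extendUnit_one, Algebra.TensorProduct.one_def, counitLeft_tmul,
        Bialgebra.counit_one, one_smul]
    have h4 : ∀ h, Coalgebra.counit (R := k) ((counitLeft k M ∘ₗ extendUnit β) h) =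
        Coalgebra.counit (R := k) h :=
      counit_of_mul'_leftInv (by rw [e, mul'_comp_extendUnit])
    refine ⟨counitLeft k M ∘ₗ extendUnit β, ⟨h3, h4, ?_⟩, extendUnit_injective ?_⟩
    · rw [gammaCompatible_iff, e, ← betaCompatible_iff]
      exact h2
    · rw [extendUnit_betaOfGamma h3 h4, e]

/-! ### The splitting -/

theorem splittingOfGamma_eq_conv (γ : H →ₗ[k] M) : splittingOfGamma D γ =
    conv ((incl D).toLinearMap ∘ₗ γ) (Phi D).toLinearMap := by
  ext h
  simp only [splittingOfGamma, LinearMap.comp_apply, conv_apply]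
  induction Coalgebra.comul (R := k) h with
  | zero => simp
  | add x y hx hy => simp only [map_add, hx, hy]
  | tmul a b =>
    have := incl_mul_Phi D (γ a) b
    rw [tm] at this
    simp [this]

theorem counitLeft_inclIncl (x : M ⊗[k] M) :
    counitLeft k (Bicross D) (inclIncl D x) = incl D (counitLeft k M x) := by
  induction x with
  | zero => simp
  | add x y hx hy => simp only [map_add, hx, hy]
  | tmul a b =>
    have e : Coalgebra.counit (R := k) (incl D a) = Coalgebra.counit (R := k) a :=
      counitHom_incl D a
    simp [inclIncl, counitLeft_tmul, e]

/-- Under `ε ⊗ id` the left factor `Φ⁻¹` becomes `ε`, the middle factor `S(γ₁) ⊗ γ₂` becomes `γ`,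
and the right factor `Φ` is kept. -/
theorem counitLeft_comp_connection {γ : H →ₗ[k] M} (hγ : γ ∈ admissibleGammas D) :
    counitLeft k (Bicross D) ∘ₗ extendUnit (connectionOfBeta D (betaOfGamma γ)) =
      splittingOfGamma D γ := by
  obtain ⟨h1, h2, -⟩ := hγ
  have e1 : ∀ h, Coalgebra.counit (R := k) (Phi D (HopfAlgebra.antipode k h)) =
      Coalgebra.counit (R := k) h := fun h =>
    (counitHom_Phi D _).trans (HopfAlgebra.counit_antipode h)
  have e2 : counitLeft k (Bicross D) ∘ₗ (inclIncl D).toLinearMap ∘ₗ leftInv k M ∘ₗ γ =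
      (incl D).toLinearMap ∘ₗ γ := by
    ext h
    simp [counitLeft_inclIncl, counitLeft_leftInv]
  rw [extendUnit_connectionOfBeta, extendUnit_betaOfGamma h1 h2, splittingOfGamma_eq_conv,
    comp_conv_conv (counitLeft k (Bicross D)) _ _ _ (convUnit k H (Bicross D))
      (Phi D).toLinearMap, e2, convUnit_conv]
  intro c x d
  refine (counitLeft_inl_mul _ _).trans ?_
  rw [convUnit_apply, ← Algebra.smul_def]
  exact congrArg₂ _ (e1 c) (counitLeft_mul_inr x _)

/-- The coproduct and antipode of `γ(h₁) ⊗ h₂` are never computed: the connection is left-invariant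
by the first bijection, hence determined by its image under `ε ⊗ id`. -/
theorem leftInv_comp_splittingOfGamma {γ : H →ₗ[k] M} (hγ : γ ∈ admissibleGammas D) :
    leftInv k (Bicross D) ∘ₗ splittingOfGamma D γ =
      extendUnit (connectionOfBeta D (betaOfGamma γ)) := by
  have h := (isLeftInvariant_iff _).1
    ((isLeftInvariant_connectionOfBeta_iff D _).2 (betaOfGamma_mem D hγ))
  rw [← counitLeft_comp_connection D hγ]
  ext x
  exact leftInv_counitLeft (LinearMap.congr_fun h x)

theorem counitLeft_deltaR₂ (u v : Bicross D) :
    (counitLeft k (Bicross D)).rTensor H (deltaR₂ (deltaRHom D).toLinearMap (u ⊗ₜ v)) =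
      (1 ⊗ₜ projHom D u) * deltaRHom D v := by
  have h := congrArg (fun t => (1 : Bicross D) ⊗ₜ[k] projHom D (TensorProduct.lid k _ t))
    (Coalgebra.rTensor_counit_comul (R := k) u)
  simp only [TensorProduct.lid_tmul, one_smul] at h
  rw [← h, deltaR₂_tmul]
  have e : deltaRHom D u =
    Algebra.TensorProduct.map (.id k (Bicross D)) (projHom D) (Coalgebra.comul u) := rfl
  simp only [coactInl, coactInr, AlgHom.comp_apply, e]
  induction Coalgebra.comul (R := k) u with
  | zero => simp
  | add x y hx hy => simp only [map_add, add_mul, TensorProduct.tmul_add, hx, hy]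
  | tmul a b =>
    induction deltaRHom D v with
    | zero => simp
    | add x y hx hy => simp only [map_add, mul_add, hx, hy]
    | tmul c d => simp [counitLeft_tmul, TensorProduct.smul_tmul']

/-- Both sides are `a₂ ⊗ π(S(a₁)) π(a₃)`, because `π` is multiplicative. This links the coaction on
forms to the adjoint coaction of `M ▶◁ H`. -/
theorem counitLeft_deltaR₂_leftInv (a : Bicross D) : (counitLeft k (Bicross D)).rTensor H
      (deltaR₂ (deltaRHom D).toLinearMap (leftInv k (Bicross D) a)) =
    (proj D).lTensor (Bicross D) (Ad k (Bicross D) a) := by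
  rw [proj_eq]
  simp only [leftInv, Ad, LinearMap.comp_apply]
  induction Coalgebra.comul (R := k) a with
  | zero => simp
  | add x y hx hy => simp only [map_add, hx, hy]
  | tmul x y =>
    have e : deltaRHom D y =
      Algebra.TensorProduct.map (.id k (Bicross D)) (projHom D) (Coalgebra.comul y) := rfl
    rw [LinearMap.rTensor_tmul, counitLeft_deltaR₂, e, LinearMap.lTensor_tmul]
    induction Coalgebra.comul (R := k) y with
    | zero => simp
    | add x y hx hy => simp only [map_add, mul_add, TensorProduct.tmul_add, hx, hy]
    | tmul z w => simp

theorem exists_splitting {γ : H →ₗ[k] M} (hγ : γ ∈ admissibleGammas D) :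
    ∃ i : kerEps k H →ₗ[k] kerEps k (Bicross D),
      (∀ h : kerEps k H, (i h : Bicross D) = splittingOfGamma D γ h) ∧
      IsSplitting (proj D) i ∧
      connectionOfBeta D (betaOfGamma γ) = canonicalConnection i := by
  have hW := leftInv_comp_splittingOfGamma D hγ
  -- `μ ∘ W = ε` for the extended connection `W`, which by `hW` is `S(i₁) ⊗ i₂`.
  have hε : ∀ h, Coalgebra.counit (R := k) (splittingOfGamma D γ h) =
      Coalgebra.counit (R := k) h :=
    counit_of_mul'_leftInv (by rw [hW, mul'_comp_extendUnit])
  have hker : ∀ h : kerEps k H, splittingOfGamma D γ h ∈ kerEps k (Bicross D) :=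
    fun h => (hε h).trans h.2
  have hone : splittingOfGamma D γ 1 = 1 := by
    rw [splittingOfGamma_eq_conv, conv_one_apply]
    simp [hγ.1]
  refine ⟨LinearMap.codRestrict _ (splittingOfGamma D γ ∘ₗ (kerEps k H).subtype) hker,
    fun h => rfl, ⟨fun h => ?_, fun h => ?_⟩, ?_⟩
  · have e1 : (projHom D).toLinearMap ∘ₗ (incl D).toLinearMap ∘ₗ γ = convUnit k H H := by
      ext x
      simp [projHom_incl, hγ.2.1, convUnit_apply]
    have e2 : (projHom D).toLinearMap ∘ₗ (Phi D).toLinearMap = LinearMap.id := by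
      ext x
      exact projHom_Phi D x
    have e3 : proj D ∘ₗ splittingOfGamma D γ = LinearMap.id := by
      rw [proj_eq, splittingOfGamma_eq_conv, algHom_comp_conv, e1, e2, convUnit_conv]
    exact LinearMap.congr_fun e3 h
  · have e1 := isConnection_connectionOfBeta D (betaOfGamma γ)
    rw [deltaR_eq, isConnection_iff] at e1
    -- Equivariance of the splitting is equivariance of the connection with `ε ⊗ id` applied to the
    -- form legs.
    have e2 := congrArg ((counitLeft k (Bicross D)).rTensor H) (LinearMap.congr_fun e1.2 h)
    rw [LinearMap.comp_apply, LinearMap.comp_apply, ← LinearMap.rTensor_comp_apply,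
      counitLeft_comp_connection D hγ, ← hW, LinearMap.comp_apply,
      counitLeft_deltaR₂_leftInv, ← rTensor_AdKer _ hone] at e2
    exact e2
  · ext1 h
    apply Subtype.ext
    have e1 : (canonicalConnection (LinearMap.codRestrict _
        (splittingOfGamma D γ ∘ₗ (kerEps k H).subtype) hker) h : Bicross D ⊗[k] Bicross D) =
        maurerCartan k (Bicross D) (splittingOfGamma D γ h) := rfl
    have e2 : Coalgebra.counit (R := k) (splittingOfGamma D γ h) = 0 := hker h
    rw [e1, maurerCartan_coe, e2, map_zero, sub_zero, ← extendUnit_coe, ← hW]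
    rfl

end Bicross

end QPB

end

theorem proposition6p1 {k M H : Type*} [Field k] [Ring M] [Ring H] [HopfAlgebra k M]
    [HopfAlgebra k H] (D : QPB.MatchedPair k M H) :
    Set.BijOn (QPB.Bicross.connectionOfBeta D)
      (QPB.Bicross.admissibleBetas D) (QPB.Bicross.strongInvariantConnections D) ∧
    Set.BijOn QPB.Bicross.betaOfGamma
      (QPB.Bicross.admissibleGammas D) (QPB.Bicross.admissibleBetas D) ∧
    ∀ γ ∈ QPB.Bicross.admissibleGammas D,
      ∃ i : QPB.kerEps k H →ₗ[k] QPB.kerEps k (QPB.Bicross D),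
        (∀ h : QPB.kerEps k H, (i h : QPB.Bicross D) = QPB.Bicross.splittingOfGamma D γ h) ∧
        QPB.IsSplitting (QPB.Bicross.proj D) i ∧
        QPB.Bicross.connectionOfBeta D (QPB.Bicross.betaOfGamma γ) =
          QPB.canonicalConnection i := by
  exact ⟨QPB.Bicross.bijOn_connectionOfBeta D, QPB.Bicross.bijOn_betaOfGamma D,
    fun _ hγ => QPB.Bicross.exists_splitting D hγ⟩
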